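/- **Setting.** Let $m\ge 1$, let $f_i:\mathbb R^n\times\mathbb R^r\to\mathbb R$ ($i=1,\dots,m$), put $g_i=-f_i$, $f=\frac1m\sum_i f_i$, $g=\frac1m\sum_i g_i=-f$. Assume, with constants $L,\mu>0$: each $f_i$ is $C^1$ and $\nabla f_i$ is $L$-Lipschitz jointly in $(x,y)$; each $g_i(x,\cdot)$ is $\mu$-strongly convex; and $\|\nabla_y f_i(x,y^*(x))\|\le C_{f,y}$ for all $i,x$, where $y^*(x)=\arg\min_y g(x,y)=\arg\max_y f(x,y)$. (Nothing is assumed about second derivatives.) Let $\Phi(x)=f(x,y^*(x))=\max_y f(x,y)$ and $\kappa=\max\{L,C_{f,y}\}/\mu$. For $\lambda\in\mathbb R$ let $$p(x,y;\lambda)=\frac1m\sum_{i=1}^m\big(f_i(x,y)+\lambda(g_i(x,y)-g_i(x,y^*(x)))\big),$$ let $y^*(x;\lambda)$ be a minimizer of $p(x,\cdot\,;\lambda)$, and let $p^*(x;\lambda)=p(x,y^*(x;\lambda);\lambda)$. **(i)** Let $\lambda\ge1$. For every $x$, $y^*(x)$ exists and is unique, $y^*(x)$ minimizes $p(x,\cdot\,;\lambda)$,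 and $p^*(x;\lambda)=\Phi(x)$; if $\lambda>1$, $y^*(x)$ is the only minimizer, so $\|y^*(x)-y^*(x;\lambda)\|^2=0$ (for $\lambda=1$ the function $p(x,\cdot\,;1)$ is constant). $\Phi$ and $p^*(\cdot;\lambda)$ are differentiable, $\nabla\Phi(x)=\nabla_xf(x,y^*(x))$ and $\|\nabla\Phi(x)-\nabla p^*(x;\lambda)\|^2=0$. Moreover $\min_x\max_yf(x,y)$ and $\min_{x,y}p(x,y;\lambda)$ are equivalent: they have the same optimal value; every solution of the first (a pair $(x,y)$ such that $x$ minimizes $\Phi$ and $y=y^*(x)$) solves the second; if $(x,y)$ solves the second then $(x,y^*(x))$ solves the first, with $y=y^*(x)$ when $\lambda>1$. **(ii)** Let in addition $r\ge1$, and let the nodes form a connected undirected graph with a symmetric doubly stochastic weight matrix $W=(w_{ij})$ with nonnegative entries such that, for $i\ne j$, $w_{ij}>0$ if $\{i,j\}$ is an edge and $w_{ij}=0$ otherwise. Let $\rho=\|W-\frac1m1_m1_m^{\mathsf T}\|^2$ (spectral norm). Assume that for all $x$, at $y=y^*(x)$, $\frac1m\sum_i\|\nabla_xf_i-\nabla_xf\|^2\le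 b_f^2$ and $\frac1m\sum_i\|\nabla_yf_i-\nabla_yf\|^2\le b_f^2$. Consider the AHEAD iteration $$z_i^{k+1}=\sum_jw_{ij}z_j^k-\gamma\nabla_yg_i(x_i^k,z_i^k),$$ $$y_i^{k+1}=\sum_jw_{ij}y_j^k-\beta\big(\nabla_yf_i(x_i^k,y_i^k)+\lambda\nabla_yg_i(x_i^k,y_i^k)\big),$$ $$x_i^{k+1}=\sum_jw_{ij}x_j^k-\alpha\big(\nabla_xf_i(x_i^k,y_i^k)+\lambda(\nabla_xg_i(x_i^k,y_i^k)-\nabla_xg_i(x_i^k,z_i^k))\big),$$ and write bars for averages over the nodes. Put $$w_\gamma=\tfrac12\tfrac{\mu L}{\mu+L},\qquad u_\beta=\tfrac{\mu}{4L},\qquad L_{y^*}=\tfrac L\mu,\qquad L_\Phi=L+LL_{y^*},$$ $$p_1=\Big(\tfrac{96L^2}{w_\gamma^2}+\tfrac{96}{u_\beta^2}+24\Big)L^2,\qquad p_2=\Big(\tfrac{96}{u_\beta^2}+24\Big)L^2,\qquad p_3=\Big(\tfrac{48}{u_\beta^2}+12\Big)L^2 .$$ Let the step sizes satisfy $$\alpha<\min\Big\{\tfrac1{2L_\Phi},\tfrac{(1-\rho)^{2/3}}{8\lambda^{2/3}p_1^{1/3}},\tfrac{w_\gamma\gamma}{16LL_{y^*}\lambda},\tfrac{\mu^2}{80L^2}\beta,\tfrac{1-\rho}{5\lambda\sqrt{p_1}},\tfrac{(1-\rho)\sqrt{p_3}}{32L\lambda\sqrt{p_1}},\tfrac{1-\rho}{54L\lambda}\Big\},$$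 $$\beta<\min\Big\{\tfrac1{\lambda L},\tfrac12\tfrac1{L+\lambda L}+\tfrac1{\lambda\mu},\tfrac{1-\rho}{10\lambda\sqrt{p_2}},\tfrac{(1-\rho)\sqrt{p_1}}{48L\lambda\sqrt{p_2}},\tfrac{1-\rho}{32L\lambda}\Big\},$$ $$\gamma<\min\Big\{\tfrac2{\mu+L},\tfrac12\tfrac{\mu+L}{\mu L},\tfrac{1-\rho}{8\sqrt{p_3}},\tfrac{(1-\rho)\sqrt{p_1}}{24L\sqrt{p_3}},\tfrac{1-\rho}{16L}\Big\}.$$ Fix constants $L>0$, $\Lambda\ge1$, $0<c\le C$ and $D$. Then there is a constant $M>0$, depending only on $L,\Lambda,c,C,D$, such that for every such problem, network, initialization and integer $K\ge1$ the following holds. If $1\le\lambda\le\Lambda$; if $\alpha$, $\beta$, $\gamma$ lie between $c$ and $C$ times $\kappa^{-2}K^{-1/3}$, $K^{-1/3}$, $K^{-1/3}$ respectively and satisfy the bounds above; and if the initial errors $\Phi(\bar x^0)-\inf\Phi$ (so $\Phi$ is bounded below), $\|\bar y^0-y^*(\bar x^0)\|^2$, $\|\bar z^0-y^*(\bar x^0)\|^2$,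 $\frac1m\sum_i\|x_i^0-\bar x^0\|^2$, $\frac1m\sum_i\|y_i^0-\bar y^0\|^2$, $\frac1m\sum_i\|z_i^0-\bar z^0\|^2$ are all at most $D$, then $$\frac1{K+1}\sum_{k=0}^K\|\nabla\Phi(\bar x^k)\|^2\le M\Big(\frac{\kappa^2}{K^{2/3}}+\frac{\kappa^2b_f^2}{(1-\rho)^2K^{2/3}}\Big).$$ -/

import Mathlib

namespace DBO

noncomputable section

/-- Euclidean space `ℝⁿ`. -/
abbrev Vec (n : ℕ) := EuclideanSpace ℝ (Fin n)

/-- Average `(1/m) ∑ᵢ vᵢ` over the nodes. -/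
def avg {m : ℕ} {A : Type*} [AddCommGroup A] [Module ℝ A] (v : Fin m → A) : A :=
  (m : ℝ)⁻¹ • ∑ i, v i

/-- The global function `h(x,y) = (1/m) ∑ᵢ hᵢ(x,y)` of a family of local functions. -/
def avgFun {m n r : ℕ} (h : Fin m → Vec n → Vec r → ℝ) (x : Vec n) (y : Vec r) : ℝ :=
  avg fun i => h i x y

/-- Partial gradient `∇ₓ φ(x,y)`. -/
def gradX {n r : ℕ} (φ : Vec n → Vec r → ℝ) (x : Vec n) (y : Vec r) : Vec n :=
  gradient (fun x' => φ x' y) x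

/-- Partial gradient `∇_y φ(x,y)`. -/
def gradY {n r : ℕ} (φ : Vec n → Vec r → ℝ) (x : Vec n) (y : Vec r) : Vec r :=
  gradient (fun y' => φ x y') y

/-- `y` is a global minimizer of `φ`. -/
def IsMinimizer {A : Type*} (φ : A → ℝ) (y : A) : Prop := ∀ y', φ y ≤ φ y'

/-- A global minimizer of `φ` (an arbitrary one if there are several,
a junk value if there is none). -/
def argmin {A : Type*} [Nonempty A] (φ : A → ℝ) : A :=
  Classical.epsilon fun y => IsMinimizer φ y

/-! ### The bilevel problem and its penalty problem -/

/-- Inner-level solution `y*(x) = argmin_y g(x,y)`. -/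
def yStar {m n r : ℕ} (g : Fin m → Vec n → Vec r → ℝ) (x : Vec n) : Vec r :=
  argmin (avgFun g x)

/-- Outer-level objective `Φ(x) = f(x, y*(x))`. -/
def Phi {m n r : ℕ} (f g : Fin m → Vec n → Vec r → ℝ) (x : Vec n) : ℝ :=
  avgFun f x (yStar g x)

/-- Penalty function
`p(x,y;λ) = (1/m) ∑ᵢ (fᵢ(x,y) + λ (gᵢ(x,y) - gᵢ(x,y*(x))))`. -/
def penalty {m n r : ℕ} (f g : Fin m → Vec n → Vec r → ℝ) (lam : ℝ) (x : Vec n) (y : Vec r) : ℝ :=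
  avg fun i => f i x y + lam * (g i x y - g i x (yStar g x))

/-- `y*(x;λ) = argmin_y p(x,y;λ)`. -/
def yPen {m n r : ℕ} (f g : Fin m → Vec n → Vec r → ℝ) (lam : ℝ) (x : Vec n) : Vec r :=
  argmin (penalty f g lam x)

/-- `p*(x;λ) = p(x, y*(x;λ); λ)`. -/
def pStar {m n r : ℕ} (f g : Fin m → Vec n → Vec r → ℝ) (lam : ℝ) (x : Vec n) : ℝ :=
  penalty f g lam x (yPen f g lam x)

/-- `(x,y)` solves `min_x max_y F(x,y)`: `y` attains the inner maximum at `x`, and the value is at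
most the inner maximum at every other `x'`. -/
def IsMinMaxSol {n r : ℕ} (F : Vec n → Vec r → ℝ) (x : Vec n) (y : Vec r) : Prop :=
  (∀ y', F x y' ≤ F x y) ∧ ∀ x' v, IsGreatest (Set.range (F x')) v → F x y ≤ v

/-! ### Assumptions -/

/-- `φ` is continuously differentiable and `L`-smooth jointly in `(x,y)`: the full gradient
`(∇ₓφ, ∇_yφ)` is `L`-Lipschitz for the Euclidean norm (written with squares). -/
structure IsSmooth {n r : ℕ} (φ : Vec n → Vec r → ℝ) (L : ℝ) : Prop where
  contDiff : ContDiff ℝ 1 fun p : Vec n × Vec r => φ p.1 p.2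
  lipschitz : ∀ x y x' y',
    ‖gradX φ x y - gradX φ x' y'‖ ^ 2 + ‖gradY φ x y - gradY φ x' y'‖ ^ 2
      ≤ L ^ 2 * (‖x - x'‖ ^ 2 + ‖y - y'‖ ^ 2)

/-- Outer-level functions: joint smoothness, and `‖∇_y fᵢ(x,y*(x))‖ ≤ C_{f,y}`. -/
structure OuterAssumption {m n r : ℕ} (f g : Fin m → Vec n → Vec r → ℝ) (Lf Cfy : ℝ) : Prop where
  smooth : ∀ i, IsSmooth (f i) Lf
  bounded : ∀ i x, ‖gradY (f i) x (yStar g x)‖ ≤ Cfy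

/-- Inner-level functions: strong convexity in `y` and joint smoothness
(nothing on second derivatives). -/
structure InnerAssumption {m n r : ℕ} (g : Fin m → Vec n → Vec r → ℝ) (μ Lg : ℝ) : Prop where
  strongConvex : ∀ i x, StrongConvexOn Set.univ μ (g i x)
  smooth : ∀ i, IsSmooth (g i) Lg

/-- The gradients `{∇ₓhᵢ}` and `{∇_y hᵢ}` have `b²`-bounded heterogeneity at all `(x,y*(x))`. -/
structure BoundedHeterogeneity {m n r : ℕ} (h g : Fin m → Vec n → Vec r → ℝ) (b : ℝ) : Prop where
  gradX_le : ∀ x, avg (fun i =>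
    ‖gradX (h i) x (yStar g x) - gradX (avgFun h) x (yStar g x)‖ ^ 2) ≤ b ^ 2
  gradY_le : ∀ x, avg (fun i =>
    ‖gradY (h i) x (yStar g x) - gradY (avgFun h) x (yStar g x)‖ ^ 2) ≤ b ^ 2

/-- The network is connected, with a symmetric doubly stochastic weight matrix supported on the
edges (and the diagonal). -/
structure NetworkAssumption {m : ℕ} (G : SimpleGraph (Fin m)) (W : Matrix (Fin m) (Fin m) ℝ) :
    Prop where
  connected : G.Connected
  symm : ∀ i j, W i j = W j i
  pos : ∀ i j, G.Adj i j → 0 < W i j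
  eq_zero : ∀ i j, i ≠ j → ¬ G.Adj i j → W i j = 0
  diag_nonneg : ∀ i, 0 ≤ W i i
  row_sum : ∀ i, ∑ j, W i j = 1
  col_sum : ∀ j, ∑ i, W i j = 1

/-- `ρ = ‖W - 1 1ᵀ/m‖²` (spectral norm). -/
def rho {m : ℕ} (W : Matrix (Fin m) (Fin m) ℝ) : ℝ :=
  ‖Matrix.toEuclideanCLM (n := Fin m) (𝕜 := ℝ) (W - Matrix.of fun _ _ => (m : ℝ)⁻¹)‖ ^ 2

/-- Condition number `κ = max{L_{f,1}, L_{g,1}, C_{f,y}} / μ_g`. -/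
def kappa (Lf Lg Cfy μ : ℝ) : ℝ := max (max Lf Lg) Cfy / μ

/-! ### The AHEAD algorithm -/

/-- The stacked states of all nodes. -/
structure State (m n r : ℕ) where
  x : Fin m → Vec n
  y : Fin m → Vec r
  z : Fin m → Vec r

/-- Mixing with the neighbours: `∑ⱼ w_{ij} vⱼ`. -/
def mix {m d : ℕ} (W : Matrix (Fin m) (Fin m) ℝ) (v : Fin m → Vec d) (i : Fin m) : Vec d :=
  ∑ j, W i j • v j

/-- One iteration of AHEAD. -/
def aheadStep {m n r : ℕ} (f g : Fin m → Vec n → Vec r → ℝ) (W : Matrix (Fin m) (Fin m) ℝ)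
    (lam α β γ : ℝ) (s : State m n r) : State m n r where
  z i := mix W s.z i - γ • gradY (g i) (s.x i) (s.z i)
  y i := mix W s.y i - β • (gradY (f i) (s.x i) (s.y i) + lam • gradY (g i) (s.x i) (s.y i))
  x i := mix W s.x i - α • (gradX (f i) (s.x i) (s.y i)
    + lam • (gradX (g i) (s.x i) (s.y i) - gradX (g i) (s.x i) (s.z i)))

/-- The state after `k` iterations of AHEAD from `s₀`. -/
def ahead {m n r : ℕ} (f g : Fin m → Vec n → Vec r → ℝ) (W : Matrix (Fin m) (Fin m) ℝ)
    (lam α β γ : ℝ) (s₀ : State m n r) (k : ℕ) : State m n r :=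
  (aheadStep f g W lam α β γ)^[k] s₀

/-- The initial errors are at most `D`: the optimality gap of `Φ` at `x̄⁰` (in particular `Φ` is
bounded below), the inner-level errors and the consensus errors. -/
structure InitialBound {m n r : ℕ} (f g : Fin m → Vec n → Vec r → ℝ) (s : State m n r) (D : ℝ) :
    Prop where
  gap : ∀ x, Phi f g (avg s.x) - Phi f g x ≤ D
  inner_y : ‖avg s.y - yStar g (avg s.x)‖ ^ 2 ≤ D
  inner_z : ‖avg s.z - yStar g (avg s.x)‖ ^ 2 ≤ D
  cons_x : avg (fun i => ‖s.x i - avg s.x‖ ^ 2) ≤ D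
  cons_y : avg (fun i => ‖s.y i - avg s.y‖ ^ 2) ≤ D
  cons_z : avg (fun i => ‖s.z i - avg s.z‖ ^ 2) ≤ D

/-! ### Step-size conditions -/

/-- `w_γ = (1/2) μ L_{g,1} / (μ + L_{g,1})`. -/
def wGamma (Lg μ : ℝ) : ℝ := 1 / 2 * (μ * Lg / (μ + Lg))

/-- `u_β = μ / (4 L_{g,1})`. -/
def uBeta (Lg μ : ℝ) : ℝ := μ / (4 * Lg)

def p₁ (Lg μ : ℝ) : ℝ :=
  (96 * Lg ^ 2 / wGamma Lg μ ^ 2 + 96 / uBeta Lg μ ^ 2 + 24) * Lg ^ 2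

def p₂ (Lg μ : ℝ) : ℝ := (96 / uBeta Lg μ ^ 2 + 24) * Lg ^ 2

def p₃ (Lg μ : ℝ) : ℝ := (48 / uBeta Lg μ ^ 2 + 12) * Lg ^ 2

/-- Upper bounds on the step sizes; `LΦ` is the Lipschitz constant used for `∇Φ`, and
`L_{y*} = L_{g,1}/μ`. -/
structure StepCondition (LΦ Lf Lg μ ρ lam α β γ : ℝ) : Prop where
  α_lt₁ : α < 1 / (2 * LΦ)
  α_lt₂ : α < (1 - ρ) ^ (2 / 3 : ℝ) / (8 * lam ^ (2 / 3 : ℝ) * p₁ Lg μ ^ (1 / 3 : ℝ))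
  α_lt₃ : α < wGamma Lg μ * γ / (16 * Lg * (Lg / μ) * lam)
  α_lt₄ : α < μ ^ 2 / (80 * Lg ^ 2) * β
  α_lt₅ : α < (1 - ρ) / (5 * lam * √(p₁ Lg μ))
  α_lt₆ : α < (1 - ρ) * √(p₃ Lg μ) / (32 * Lg * lam * √(p₁ Lg μ))
  α_lt₇ : α < (1 - ρ) / (54 * Lg * lam)
  β_lt₁ : β < 1 / (lam * Lg)
  β_lt₂ : β < 1 / 2 * (1 / (Lf + lam * Lg)) + 1 / (lam * μ)
  β_lt₃ : β < (1 - ρ) / (10 * lam * √(p₂ Lg μ))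
  β_lt₄ : β < (1 - ρ) * √(p₁ Lg μ) / (48 * Lg * lam * √(p₂ Lg μ))
  β_lt₅ : β < (1 - ρ) / (32 * Lg * lam)
  γ_lt₁ : γ < 2 / (μ + Lg)
  γ_lt₂ : γ < 1 / 2 * ((μ + Lg) / (μ * Lg))
  γ_lt₃ : γ < (1 - ρ) / (8 * √(p₃ Lg μ))
  γ_lt₄ : γ < (1 - ρ) * √(p₁ Lg μ) / (24 * Lg * √(p₃ Lg μ))
  γ_lt₅ : γ < (1 - ρ) / (16 * Lg)

/-- `t` is of exact order `s`, with constants `c` and `C`. -/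
def OfOrder (c C t s : ℝ) : Prop := c * s ≤ t ∧ t ≤ C * s

end

end DBO

open DBO

open scoped RealInnerProductSpace Topology

namespace DBO

/-! ### Strong convexity and Taylor remainders in Hilbert space -/

section Analysis

variable {E : Type*} [NormedAddCommGroup E] [InnerProductSpace ℝ E] [CompleteSpace E]

/-! Since g = -f, the penalty function collapses to p(x,y;λ) = Φ(x) + (λ-1)(g(x,y) - g(x,y*(x)))
(`penalty_eq`). The second term is nonnegative, vanishes at y*(x), and for λ > 1 vanishes nowhere
else; the claims of (i) on values, minimizers and solutions follow. Differentiability is Danskin's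
theorem with a quadratic remainder (`abs_Phi_sub_le`): f(·,y*(x)) and f(·,y*(x')) lie below Φ and
touch it at x and x', and y* is L/μ-Lipschitz.

For (ii), g = -f turns the y-update into a decentralized gradient step on g of length β(λ-1), so y
and z both track y*(x̄). The x-direction of node i becomes -(λ-1)∇ₓfᵢ(xᵢ,yᵢ) + λ∇ₓfᵢ(xᵢ,zᵢ). These
weights add up to 1, so the penalty leaves no bias: the deviation from ∇ₓfᵢ(x̄,y*(x̄)) is controlled
by consensus and tracking errors alone.

There are six one-step estimates. The three consensus errors contract by (1+ρ)/2, up to squared step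
sizes times heterogeneity and other errors (`consensus_step`). The two tracking errors contract up
to consensus errors and the drift of y* (`innerError_step`). Φ descends, with a multiple of the
squared mean direction to spare (`Phi_step`). Each estimate is summed over the trajectory by itself,
and the resulting linear system of inequalities between the sums is solved in
`sum_gradient_sq_le_of_recursions`: the step-size bounds make the feedback coefficients small, and
the spare direction term absorbs the drift of y*. What remains is D/α, start-up terms, and the
number of iterations times squared step sizes times κ²b²/(1-ρ)²; steps of order K^(-1/3) balance
these (`rate_of_sum_le`). -/

/-- First-order lower bound for strongly convex functions. -/
theorem strongConvexOn_add_inner_le {φ : E → ℝ} {μ : ℝ} {v y : E}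
    (h : StrongConvexOn Set.univ μ φ) (hv : HasGradientAt φ v y) (y' : E) :
    φ y + ⟪v, y' - y⟫ + μ / 2 * ‖y' - y‖ ^ 2 ≤ φ y' := by
  set q := μ / 2 * ‖y' - y‖ ^ 2 with hq
  have hline : HasDerivAt (fun t : ℝ => y + t • (y' - y)) (y' - y) 0 := by
    simpa using ((hasDerivAt_id (0 : ℝ)).smul_const (y' - y)).const_add y
  have hfd : HasFDerivAt φ (InnerProductSpace.toDual ℝ E v) (y + (0 : ℝ) • (y' - y)) := by
    simpa using hv.hasFDerivAt
  have hd : HasDerivAt (fun t : ℝ => φ (y + t • (y' - y))) ⟪v, y' - y⟫ 0 := by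
    simpa [Function.comp_def] using hfd.comp_hasDerivAt (0 : ℝ) hline
  have hr : HasDerivAt (fun t : ℝ => t * (φ y' - φ y) - t * (1 - t) * q)
      (φ y' - φ y - q) 0 := by
    have h1 := (hasDerivAt_id (0 : ℝ)).mul_const (φ y' - φ y)
    have h2 := (((hasDerivAt_id (0 : ℝ)).mul
      ((hasDerivAt_const (0 : ℝ) (1 : ℝ)).sub (hasDerivAt_id (0 : ℝ)))).mul_const q)
    exact (h1.sub h2).congr_deriv (by simp)
  -- On [0,1] strong convexity says that the chord minus the quadratic correction dominates φ along
  -- the segment, with equality at t = 0. Hence the right derivative of the difference at 0 is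
  -- nonnegative.
  have hs := (hr.sub hd).tendsto_slope_zero_right
  have hnn : 0 ≤ φ y' - φ y - q - ⟪v, y' - y⟫ := by
    refine ge_of_tendsto hs ?_
    have hmem : Set.Ioo (0 : ℝ) 1 ∈ 𝓝[>] (0 : ℝ) := Ioo_mem_nhdsGT one_pos
    filter_upwards [hmem] with t ht
    have hc := h.2 (Set.mem_univ y) (Set.mem_univ y') (sub_nonneg.2 ht.2.le) ht.1.le
      (sub_add_cancel 1 t)
    have he : (1 - t) • y + t • y' = y + t • (y' - y) := by
      rw [sub_smul, smul_sub, one_smul]; abel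
    rw [he, norm_sub_rev] at hc
    have hc' : φ (y + t • (y' - y)) ≤ (1 - t) * φ y + t * φ y' - (1 - t) * t * q := by
      simpa [hq] using hc
    refine mul_nonneg (inv_nonneg.2 ht.1.le) ?_
    simp only [zero_add, Pi.sub_apply, zero_mul, zero_smul, add_zero, sub_self]
    nlinarith
  linarith

/-- Adding the first-order bounds at y and at y' cancels the function values. -/
theorem inner_gradient_sub_ge {φ : E → ℝ} {μ : ℝ} {v v' y y' : E}
    (h : StrongConvexOn Set.univ μ φ) (hv : HasGradientAt φ v y) (hv' : HasGradientAt φ v' y') :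
    μ * ‖y - y'‖ ^ 2 ≤ ⟪v - v', y - y'⟫ := by
  have h1 := strongConvexOn_add_inner_le h hv y'
  have h2 := strongConvexOn_add_inner_le h hv' y
  have h3 : ⟪v, y' - y⟫ = - ⟪v, y - y'⟫ := by rw [← inner_neg_right, neg_sub]
  rw [norm_sub_rev y' y] at h1
  rw [inner_sub_left]
  linarith

/-- Quadratic control of the first-order Taylor remainder under a Lipschitz gradient. -/
theorem abs_sub_sub_inner_le {φ : E → ℝ} {v : E → E} {L : ℝ} (hL : 0 ≤ L)
    (hv : ∀ x, HasGradientAt φ (v x) x) (hlip : ∀ x x', ‖v x - v x'‖ ≤ L * ‖x - x'‖) (x x' : E) :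
    |φ x' - φ x - ⟪v x, x' - x⟫| ≤ L * ‖x' - x‖ ^ 2 := by
  -- Mean value inequality on the ball of radius ‖x' - x‖, where the gradient differs from v x by at
  -- most L‖x' - x‖. This costs a factor 2 against the sharp constant L/2.
  have key := Convex.norm_image_sub_le_of_norm_hasFDerivWithin_le' (𝕜 := ℝ) (f := φ)
    (f' := fun z => InnerProductSpace.toDual ℝ E (v z)) (φ := InnerProductSpace.toDual ℝ E (v x))
    (C := L * ‖x' - x‖) (s := Metric.closedBall x ‖x' - x‖) (x := x) (y := x')
    (fun z _ => (hv z).hasFDerivAt.hasFDerivWithinAt)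
    (fun z hz => by
      rw [← map_sub, LinearIsometryEquiv.norm_map]
      refine (hlip z x).trans (mul_le_mul_of_nonneg_left ?_ hL)
      simpa [dist_eq_norm] using hz)
    (convex_closedBall _ _) (by simp) (by simp [dist_eq_norm])
  simpa [pow_two, mul_assoc] using key

/-- The first-order bound at 0 makes φ coercive: the quadratic term beats the linear one. -/
theorem exists_isMinimizer_of_strongConvexOn [FiniteDimensional ℝ E] {φ : E → ℝ} {μ : ℝ}
    (hμ : 0 < μ) (h : StrongConvexOn Set.univ μ φ) (hd : Differentiable ℝ φ) :
    ∃ y, IsMinimizer φ y := by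
  refine hd.continuous.exists_forall_le ?_
  have hv := (hd 0).hasGradientAt
  set v := gradient φ 0
  have hlow : ∀ y, φ 0 + ‖y‖ * (μ / 2 * ‖y‖ - ‖v‖) ≤ φ y := fun y => by
    have h1 := strongConvexOn_add_inner_le h hv y
    have h2 : -(‖v‖ * ‖y‖) ≤ ⟪v, y⟫ := (abs_le.1 (abs_real_inner_le_norm v y)).1
    simp only [sub_zero] at h1
    nlinarith
  refine Filter.tendsto_atTop_mono hlow (Filter.tendsto_atTop_add_const_left _ _ ?_)
  have hn := tendsto_norm_cocompact_atTop (E := E)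
  refine hn.atTop_mul_atTop₀ ?_
  exact Filter.tendsto_atTop_add_const_right _ _ (hn.const_mul_atTop (by positivity))

end Analysis

/-! ### Averages -/

section Averages

variable {m : ℕ} {E : Type*} [NormedAddCommGroup E] [InnerProductSpace ℝ E]

theorem avg_mono {u v : Fin m → ℝ} (h : ∀ i, u i ≤ v i) : avg u ≤ avg v := by
  simp only [avg, smul_eq_mul]
  exact mul_le_mul_of_nonneg_left (Finset.sum_le_sum fun i _ => h i) (by positivity)

theorem avg_nonneg {u : Fin m → ℝ} (h : ∀ i, 0 ≤ u i) : 0 ≤ avg u := by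
  simp only [avg, smul_eq_mul]
  exact mul_nonneg (by positivity) (Finset.sum_nonneg fun i _ => h i)

theorem avg_add {A : Type*} [AddCommGroup A] [Module ℝ A] (u v : Fin m → A) :
    avg (fun i => u i + v i) = avg u + avg v := by
  simp [avg, Finset.sum_add_distrib]

theorem avg_sub {A : Type*} [AddCommGroup A] [Module ℝ A] (u v : Fin m → A) :
    avg (fun i => u i - v i) = avg u - avg v := by
  simp [avg, Finset.sum_sub_distrib, smul_sub]

theorem avg_neg {A : Type*} [AddCommGroup A] [Module ℝ A] (u : Fin m → A) :
    avg (fun i => - u i) = - avg u := by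
  simp [avg]

theorem avg_smul {A : Type*} [AddCommGroup A] [Module ℝ A] (c : ℝ) (u : Fin m → A) :
    avg (fun i => c • u i) = c • avg u := by
  simp only [avg]
  rw [← Finset.smul_sum, smul_comm]

theorem avg_mul (c : ℝ) (u : Fin m → ℝ) : avg (fun i => c * u i) = c * avg u :=
  avg_smul c u

theorem avg_const {A : Type*} [AddCommGroup A] [Module ℝ A] (hm : 0 < m) (a : A) :
    avg (fun _ : Fin m => a) = a := by
  have : (m : ℝ) ≠ 0 := by exact_mod_cast hm.ne'
  simp [avg, ← Nat.cast_smul_eq_nsmul ℝ, smul_smul, this]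

theorem avg_inner (u : Fin m → E) (w : E) : avg (fun i => ⟪u i, w⟫) = ⟪avg u, w⟫ := by
  simp [avg, inner_smul_left, sum_inner]

/-- Bias-variance decomposition. -/
theorem avg_norm_sub_sq (hm : 0 < m) (v : Fin m → E) (w : E) :
    avg (fun i => ‖v i - w‖ ^ 2) = avg (fun i => ‖v i - avg v‖ ^ 2) + ‖avg v - w‖ ^ 2 := by
  have h : ∀ i, ‖v i - w‖ ^ 2
      = ‖v i - avg v‖ ^ 2 + (2 * ⟪v i - avg v, avg v - w⟫ + ‖avg v - w‖ ^ 2) := fun i => by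
    rw [← sub_add_sub_cancel (v i) (avg v) w, norm_add_sq_real]; ring
  have h0 : avg (fun i => ⟪v i - avg v, avg v - w⟫) = 0 := by
    rw [avg_inner (fun i => v i - avg v), avg_sub, avg_const hm, sub_self, inner_zero_left]
  simp only [h]
  rw [avg_add, avg_add, avg_mul, h0, avg_const hm]
  ring

theorem norm_avg_sq_le (hm : 0 < m) (v : Fin m → E) : ‖avg v‖ ^ 2 ≤ avg fun i => ‖v i‖ ^ 2 := by
  have h := avg_norm_sub_sq hm v 0
  simp only [sub_zero] at h
  rw [h]
  exact le_add_of_nonneg_left (avg_nonneg fun i => by positivity)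

theorem avg_norm_sub_avg_sq_le (hm : 0 < m) (v : Fin m → E) :
    avg (fun i => ‖v i - avg v‖ ^ 2) ≤ avg fun i => ‖v i‖ ^ 2 := by
  have h := avg_norm_sub_sq hm v 0
  simp only [sub_zero] at h
  rw [h]
  exact le_add_of_nonneg_right (by positivity)

theorem norm_add_sq_le_two (a b : E) : ‖a + b‖ ^ 2 ≤ 2 * ‖a‖ ^ 2 + 2 * ‖b‖ ^ 2 := by
  have := parallelogram_law_with_norm ℝ a b
  nlinarith [sq_nonneg ‖a - b‖]

/-- Young's inequality for the square of a sum of norms. -/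
theorem norm_add_sq_le_young {F : Type*} [SeminormedAddCommGroup F] {η : ℝ} (hη : 0 < η) (a b : F) :
    ‖a + b‖ ^ 2 ≤ (1 + η) * ‖a‖ ^ 2 + (1 + η⁻¹) * ‖b‖ ^ 2 := by
  have h1 : ‖a + b‖ ^ 2 ≤ (‖a‖ + ‖b‖) ^ 2 := by gcongr; exact norm_add_le a b
  have h2 : 0 ≤ (η * ‖a‖ - ‖b‖) ^ 2 * η⁻¹ := by positivity
  have h3 : (η * ‖a‖ - ‖b‖) ^ 2 * η⁻¹
      = η * ‖a‖ ^ 2 - 2 * ‖a‖ * ‖b‖ + η⁻¹ * ‖b‖ ^ 2 := by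
    field_simp; ring
  nlinarith

/-- Heterogeneity is bounded only at points (x, y*(x)). This transfers the bound to directions
evaluated at the nodes' own iterates. -/
theorem avg_dispersion_le_of_near (hm : 0 < m) (u h : Fin m → E) :
    avg (fun i => ‖u i - avg u‖ ^ 2)
      ≤ 2 * avg (fun i => ‖h i - avg h‖ ^ 2) + 2 * avg (fun i => ‖u i - h i‖ ^ 2) := by
  have h1 : ∀ i, ‖u i - avg u‖ ^ 2 ≤ 2 * ‖h i - avg h‖ ^ 2
      + 2 * ‖(u i - h i) - avg (fun i => u i - h i)‖ ^ 2 := fun i => by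
    rw [avg_sub]
    convert norm_add_sq_le_two (h i - avg h) ((u i - h i) - (avg u - avg h)) using 3
    abel
  refine (avg_mono h1).trans ?_
  rw [avg_add, avg_mul, avg_mul]
  have := avg_norm_sub_avg_sq_le hm fun i => u i - h i
  linarith

end Averages

/-! ### Mixing -/

section Mixing

variable {m d : ℕ} {G : SimpleGraph (Fin m)} {W : Matrix (Fin m) (Fin m) ℝ}

theorem rho_nonneg (W : Matrix (Fin m) (Fin m) ℝ) : 0 ≤ rho W := by unfold rho; positivity

theorem NetworkAssumption.pos_card (h : NetworkAssumption G W) : 0 < m := by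
  obtain ⟨i⟩ := h.connected.nonempty
  exact i.pos

theorem NetworkAssumption.avg_mix (h : NetworkAssumption G W) (v : Fin m → Vec d) :
    avg (mix W v) = avg v := by
  simp only [avg, mix]
  rw [Finset.sum_comm]
  simp [← Finset.sum_smul, h.col_sum]

/-- Coordinate by coordinate, the centred values sum to zero, so the averaging matrix `J` kills them
and W acts on them as W - J, whose squared operator norm is ρ. -/
theorem NetworkAssumption.avg_mix_dispersion_le (h : NetworkAssumption G W) (v : Fin m → Vec d) :
    avg (fun i => ‖mix W v i - avg v‖ ^ 2) ≤ rho W * avg (fun i => ‖v i - avg v‖ ^ 2) := by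
  set J : Matrix (Fin m) (Fin m) ℝ := Matrix.of fun _ _ => (m : ℝ)⁻¹ with hJ
  have key : ∀ c : Fin d, ∑ i, (mix W v i - avg v) c ^ 2 ≤ rho W * ∑ i, (v i - avg v) c ^ 2 := by
    intro c
    have hop := (Matrix.toEuclideanCLM (n := Fin m) (𝕜 := ℝ) (W - J)).le_opNorm
      (WithLp.toLp 2 fun i => (v i - avg v) c)
    have hsq := pow_le_pow_left₀ (norm_nonneg _) hop 2
    rw [mul_pow, Matrix.toEuclideanCLM_toLp, EuclideanSpace.norm_sq_eq,
      EuclideanSpace.norm_sq_eq] at hsq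
    simp only [Real.norm_eq_abs, sq_abs] at hsq
    have hval : ∀ i, (Matrix.mulVec (W - J) fun i => (v i - avg v) c) i
        = (mix W v i - avg v) c := by
      intro i
      have hz : ∑ j, (v j - avg v) c = 0 := by
        have h0 : ∑ j, (v j - avg v) = 0 := by
          have hm : (m : ℝ) ≠ 0 := by exact_mod_cast h.pos_card.ne'
          simp [Finset.sum_sub_distrib, avg, ← Nat.cast_smul_eq_nsmul ℝ, smul_smul, hm]
        have := congrArg (fun w : Vec d => w c) h0
        simpa using this
      have hw : mix W v i - avg v = ∑ j, W i j • (v j - avg v) := by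
        simp [mix, smul_sub, Finset.sum_sub_distrib, ← Finset.sum_smul, h.row_sum]
      rw [hw]
      simp only [Matrix.mulVec, dotProduct, Matrix.sub_apply, sub_mul, Finset.sum_sub_distrib]
      simp only [hJ, Matrix.of_apply, ← Finset.mul_sum, hz, mul_zero, sub_zero]
      simp
    simp only [hval] at hsq
    exact hsq
  simp only [avg, smul_eq_mul]
  rw [mul_left_comm]
  refine mul_le_mul_of_nonneg_left ?_ (by positivity)
  simp only [EuclideanSpace.norm_sq_eq, Real.norm_eq_abs, sq_abs]
  rw [Finset.sum_comm, Finset.sum_comm (s := Finset.univ) (t := Finset.univ)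
    (f := fun i c => ((v i - _ : Vec d) c) ^ 2), Finset.mul_sum]
  exact Finset.sum_le_sum fun c _ => key c

/-- Contraction of the consensus error under a perturbed mixing step. -/
theorem NetworkAssumption.consensus_step (h : NetworkAssumption G W) (hρ : rho W < 1)
    (v u : Fin m → Vec d) (t : ℝ) :
    avg (fun i => ‖(mix W v i - t • u i) - avg (fun i => mix W v i - t • u i)‖ ^ 2)
      ≤ (1 + rho W) / 2 * avg (fun i => ‖v i - avg v‖ ^ 2)
        + 3 / (1 - rho W) * t ^ 2 * avg (fun i => ‖u i - avg u‖ ^ 2) := by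
  have hδ : 0 < 1 - rho W := by linarith
  have hρ0 := rho_nonneg W
  have havg : avg (fun i => mix W v i - t • u i) = avg v - t • avg u := by
    rw [avg_sub, avg_smul, h.avg_mix v]
  -- Young with η = (1-ρ)/2: then (1+η)ρ ≤ (1+ρ)/2 and 1 + 1/η ≤ 3/(1-ρ).
  have h1 : ∀ i, ‖(mix W v i - t • u i) - avg (fun i => mix W v i - t • u i)‖ ^ 2
      ≤ (1 + (1 - rho W) / 2) * ‖mix W v i - avg v‖ ^ 2
        + (1 + ((1 - rho W) / 2)⁻¹) * (t ^ 2 * ‖u i - avg u‖ ^ 2) := fun i => by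
    have := norm_add_sq_le_young (half_pos hδ) (mix W v i - avg v) (-(t • (u i - avg u)))
    rw [norm_neg, norm_smul, mul_pow, Real.norm_eq_abs, sq_abs] at this
    have he : (mix W v i - t • u i) - avg (fun i => mix W v i - t • u i)
        = mix W v i - avg v + -(t • (u i - avg u)) := by
      rw [havg, smul_sub]; abel
    rw [he]
    exact this
  refine (avg_mono h1).trans ?_
  rw [avg_add, avg_mul, avg_mul, avg_mul]
  have h2 := h.avg_mix_dispersion_le v
  have hV : 0 ≤ avg (fun i => ‖v i - avg v‖ ^ 2) := avg_nonneg fun i => by positivity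
  have hU : 0 ≤ avg (fun i => ‖u i - avg u‖ ^ 2) := avg_nonneg fun i => by positivity
  have h3 : (1 + (1 - rho W) / 2) * avg (fun i => ‖mix W v i - avg v‖ ^ 2)
      ≤ (1 + rho W) / 2 * avg (fun i => ‖v i - avg v‖ ^ 2) := by
    calc _ ≤ (1 + (1 - rho W) / 2) * (rho W * avg (fun i => ‖v i - avg v‖ ^ 2)) := by gcongr
      _ ≤ _ := by
        rw [← mul_assoc]
        refine mul_le_mul_of_nonneg_right ?_ hV
        nlinarith [sq_nonneg (1 - rho W)]
  have h4 : 1 + ((1 - rho W) / 2)⁻¹ ≤ 3 / (1 - rho W) := by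
    rw [inv_div, le_div_iff₀ hδ, add_mul, div_mul_cancel₀ _ hδ.ne']
    linarith
  have h5 : (1 + ((1 - rho W) / 2)⁻¹) * (t ^ 2 * avg (fun i => ‖u i - avg u‖ ^ 2))
      ≤ 3 / (1 - rho W) * (t ^ 2 * avg (fun i => ‖u i - avg u‖ ^ 2)) := by gcongr
  linarith

end Mixing

/-- Telescoping of a one-step Lyapunov inequality. -/
theorem sum_add_le_of_step {V c b : ℕ → ℝ} (h : ∀ k, V (k + 1) + c k ≤ V k + b k) (N : ℕ) :
    ∑ k ∈ Finset.range N, c k + V N ≤ V 0 + ∑ k ∈ Finset.range N, b k := by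
  induction N with
  | zero => simp
  | succ N ih => rw [Finset.sum_range_succ, Finset.sum_range_succ]; linarith [h N]

/-! ### Smoothness of the local and global functions -/

section Smooth

variable {m n r : ℕ}

theorem hasGradientAt_avg {E : Type*} [NormedAddCommGroup E] [InnerProductSpace ℝ E]
    [CompleteSpace E] {φ : Fin m → E → ℝ} {v : Fin m → E} {x : E}
    (h : ∀ i, HasGradientAt (φ i) (v i) x) :
    HasGradientAt (fun x' => avg fun i => φ i x') (avg v) x := by
  rw [hasGradientAt_iff_hasFDerivAt]
  have h1 := (HasFDerivAt.fun_sum fun i (_ : i ∈ Finset.univ) => (h i).hasFDerivAt).const_smul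
    (m : ℝ)⁻¹
  have h2 : (InnerProductSpace.toDual ℝ E) (avg v)
      = (m : ℝ)⁻¹ • ∑ i, (InnerProductSpace.toDual ℝ E) (v i) := by
    simp [avg, map_sum]
  rw [h2]
  exact h1

theorem IsSmooth.hasGradientAt_left {φ : Vec n → Vec r → ℝ} {L : ℝ} (h : IsSmooth φ L)
    (x : Vec n) (y : Vec r) : HasGradientAt (fun x' => φ x' y) (gradX φ x y) x := by
  refine DifferentiableAt.hasGradientAt ?_
  have h1 : ContDiff ℝ 1 (fun x' : Vec n => ((x', y) : Vec n × Vec r)) :=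
    contDiff_id.prodMk contDiff_const
  exact ((h.contDiff.comp h1).differentiable one_ne_zero) x

theorem IsSmooth.hasGradientAt_right {φ : Vec n → Vec r → ℝ} {L : ℝ} (h : IsSmooth φ L)
    (x : Vec n) (y : Vec r) : HasGradientAt (φ x) (gradY φ x y) y := by
  refine DifferentiableAt.hasGradientAt ?_
  have h1 : ContDiff ℝ 1 (fun y' : Vec r => ((x, y') : Vec n × Vec r)) :=
    contDiff_const.prodMk contDiff_id
  exact ((h.contDiff.comp h1).differentiable one_ne_zero) y

theorem IsSmooth.gradX_sub_sq_le {φ : Vec n → Vec r → ℝ} {L : ℝ} (h : IsSmooth φ L)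
    (x x' : Vec n) (y y' : Vec r) :
    ‖gradX φ x y - gradX φ x' y'‖ ^ 2 ≤ L ^ 2 * (‖x - x'‖ ^ 2 + ‖y - y'‖ ^ 2) :=
  (le_add_of_nonneg_right (by positivity)).trans (h.lipschitz x y x' y')

theorem IsSmooth.gradY_sub_sq_le {φ : Vec n → Vec r → ℝ} {L : ℝ} (h : IsSmooth φ L)
    (x x' : Vec n) (y y' : Vec r) :
    ‖gradY φ x y - gradY φ x' y'‖ ^ 2 ≤ L ^ 2 * (‖x - x'‖ ^ 2 + ‖y - y'‖ ^ 2) :=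
  (le_add_of_nonneg_left (by positivity)).trans (h.lipschitz x y x' y')

theorem gradX_avgFun {h : Fin m → Vec n → Vec r → ℝ} {L : ℝ} (hs : ∀ i, IsSmooth (h i) L)
    (x : Vec n) (y : Vec r) : gradX (avgFun h) x y = avg fun i => gradX (h i) x y :=
  (hasGradientAt_avg fun i => (hs i).hasGradientAt_left x y).gradient

theorem gradY_avgFun {h : Fin m → Vec n → Vec r → ℝ} {L : ℝ} (hs : ∀ i, IsSmooth (h i) L)
    (x : Vec n) (y : Vec r) : gradY (avgFun h) x y = avg fun i => gradY (h i) x y :=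
  (hasGradientAt_avg fun i => (hs i).hasGradientAt_right x y).gradient

theorem isSmooth_avgFun (hm : 0 < m) {h : Fin m → Vec n → Vec r → ℝ} {L : ℝ}
    (hs : ∀ i, IsSmooth (h i) L) : IsSmooth (avgFun h) L where
  contDiff := by
    unfold avgFun avg
    exact (ContDiff.sum fun i _ => (hs i).contDiff).const_smul _
  lipschitz x y x' y' := by
    rw [gradX_avgFun hs, gradX_avgFun hs, gradY_avgFun hs, gradY_avgFun hs, ← avg_sub, ← avg_sub]
    refine (add_le_add (norm_avg_sq_le hm _) (norm_avg_sq_le hm _)).trans ?_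
    rw [← avg_add]
    refine (avg_mono fun i => (hs i).lipschitz x y x' y').trans_eq ?_
    rw [avg_const hm]

theorem strongConvexOn_avgFun (hm : 0 < m) {h : Fin m → Vec n → Vec r → ℝ} {μ : ℝ} {x : Vec n}
    (hs : ∀ i, StrongConvexOn Set.univ μ (h i x)) : StrongConvexOn Set.univ μ (avgFun h x) := by
  refine ⟨convex_univ, fun y hy y' hy' a b ha hb hab => ?_⟩
  refine (avg_mono fun i => (hs i).2 hy hy' ha hb hab).trans_eq ?_
  simp only [smul_eq_mul]
  rw [avg_sub, avg_add, avg_mul, avg_mul, avg_const hm]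
  rfl

theorem gradX_neg (φ : Vec n → Vec r → ℝ) (x : Vec n) (y : Vec r) :
    gradX (fun x y => - φ x y) x y = - gradX φ x y := by
  simp [gradX, gradient, fderiv_fun_neg]

theorem gradY_neg (φ : Vec n → Vec r → ℝ) (x : Vec n) (y : Vec r) :
    gradY (fun x y => - φ x y) x y = - gradY φ x y := by
  simp [gradY, gradient, fderiv_fun_neg]

theorem le_mul_of_sq_le {a b L : ℝ} (hL : 0 ≤ L) (hb : 0 ≤ b) (h : a ^ 2 ≤ L ^ 2 * b ^ 2) :
    a ≤ L * b := by
  rw [← mul_pow] at h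
  exact le_of_sq_le_sq h (by positivity)

end Smooth

/-! ### The concave inner problem -/

/-- Smooth functions `fᵢ` whose negatives `gᵢ` are strongly convex in the second variable. -/
structure StronglyConcaveFamily {m n r : ℕ} (f g : Fin m → Vec n → Vec r → ℝ) (L μ : ℝ) :
    Prop where
  m_pos : 0 < m
  L_pos : 0 < L
  μ_pos : 0 < μ
  g_eq : ∀ i x y, g i x y = -f i x y
  smooth_f : ∀ i, IsSmooth (f i) L
  smooth_g : ∀ i, IsSmooth (g i) L
  strongConvex : ∀ i x, StrongConvexOn Set.univ μ (g i x)

namespace StronglyConcaveFamily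

variable {m n r : ℕ} {f g : Fin m → Vec n → Vec r → ℝ} {L μ : ℝ}

theorem avgFun_eq (h : StronglyConcaveFamily f g L μ) (x : Vec n) (y : Vec r) :
    avgFun g x y = - avgFun f x y := by
  simp only [avgFun, h.g_eq]
  exact avg_neg _

theorem gradX_eq (h : StronglyConcaveFamily f g L μ) (i : Fin m) (x : Vec n) (y : Vec r) :
    gradX (g i) x y = - gradX (f i) x y := by
  rw [← gradX_neg]
  congr 1
  funext x y
  exact h.g_eq i x y

theorem gradY_eq (h : StronglyConcaveFamily f g L μ) (i : Fin m) (x : Vec n) (y : Vec r) :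
    gradY (g i) x y = - gradY (f i) x y := by
  rw [← gradY_neg]
  congr 1
  funext x y
  exact h.g_eq i x y

theorem smooth_avg_f (h : StronglyConcaveFamily f g L μ) : IsSmooth (avgFun f) L :=
  isSmooth_avgFun h.m_pos h.smooth_f

theorem smooth_avg_g (h : StronglyConcaveFamily f g L μ) : IsSmooth (avgFun g) L :=
  isSmooth_avgFun h.m_pos h.smooth_g

theorem strongConvex_avg (h : StronglyConcaveFamily f g L μ) (x : Vec n) :
    StrongConvexOn Set.univ μ (avgFun g x) :=
  strongConvexOn_avgFun h.m_pos fun i => h.strongConvex i x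

theorem isMinimizer_yStar (h : StronglyConcaveFamily f g L μ) (x : Vec n) :
    IsMinimizer (avgFun g x) (yStar g x) :=
  Classical.epsilon_spec (exists_isMinimizer_of_strongConvexOn h.μ_pos (h.strongConvex_avg x)
    fun y => (h.smooth_avg_g.hasGradientAt_right x y).differentiableAt)

theorem gradY_yStar (h : StronglyConcaveFamily f g L μ) (x : Vec n) :
    gradY (avgFun g) x (yStar g x) = 0 := by
  have hmin : IsLocalMin (avgFun g x) (yStar g x) :=
    Filter.Eventually.of_forall (h.isMinimizer_yStar x)
  simp [gradY, gradient, hmin.fderiv_eq_zero]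

theorem inner_gradY_sub_ge (h : StronglyConcaveFamily f g L μ) (x : Vec n) (y y' : Vec r) :
    μ * ‖y - y'‖ ^ 2 ≤ ⟪gradY (avgFun g) x y - gradY (avgFun g) x y', y - y'⟫ :=
  inner_gradient_sub_ge (h.strongConvex_avg x) (h.smooth_avg_g.hasGradientAt_right x y)
    (h.smooth_avg_g.hasGradientAt_right x y')

theorem isMinimizer_iff (h : StronglyConcaveFamily f g L μ) (x : Vec n) (y : Vec r) :
    IsMinimizer (avgFun g x) y ↔ y = yStar g x := by
  refine ⟨fun hy => ?_, fun hy => hy ▸ h.isMinimizer_yStar x⟩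
  have h1 := strongConvexOn_add_inner_le (h.strongConvex_avg x)
    (h.smooth_avg_g.hasGradientAt_right x (yStar g x)) y
  rw [h.gradY_yStar, inner_zero_left] at h1
  have h2 : μ / 2 * ‖y - yStar g x‖ ^ 2 ≤ 0 := by linarith [hy (yStar g x)]
  have h3 : ‖y - yStar g x‖ ^ 2 ≤ 0 := by
    by_contra hc
    push Not at hc
    have := mul_pos (half_pos h.μ_pos) hc
    linarith
  have h4 : ‖y - yStar g x‖ = 0 := by nlinarith [norm_nonneg (y - yStar g x)]
  exact sub_eq_zero.1 (norm_eq_zero.1 h4)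

/-- Strong monotonicity of ∇_y g(x,·) is tested at y*(x) and y*(x'). Both ∇_y g(x,y*(x)) and ∇_y
g(x',y*(x')) vanish, so the gradient difference is only a change of the x-argument. -/
theorem yStar_lipschitz (h : StronglyConcaveFamily f g L μ) (x x' : Vec n) :
    ‖yStar g x - yStar g x'‖ ≤ L / μ * ‖x - x'‖ := by
  set y := yStar g x with hy
  set y' := yStar g x' with hy'
  have h1 := h.inner_gradY_sub_ge x y y'
  have hg : ‖gradY (avgFun g) x y - gradY (avgFun g) x y'‖ ≤ L * ‖x - x'‖ := by
    rw [hy, h.gradY_yStar x, ← h.gradY_yStar x', norm_sub_rev]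
    refine le_mul_of_sq_le h.L_pos.le (norm_nonneg _) ?_
    simpa [hy'] using h.smooth_avg_g.gradY_sub_sq_le x x' y' y'
  have h2 := real_inner_le_norm (gradY (avgFun g) x y - gradY (avgFun g) x y') (y - y')
  rw [div_mul_eq_mul_div, le_div_iff₀ h.μ_pos]
  rcases (norm_nonneg (y - y')).eq_or_lt with h0 | h0
  · rw [← h0, zero_mul]
    exact mul_nonneg h.L_pos.le (norm_nonneg _)
  · refine le_of_mul_le_mul_right ?_ h0
    nlinarith

theorem avgFun_le_Phi (h : StronglyConcaveFamily f g L μ) (x : Vec n) (y : Vec r) :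
    avgFun f x y ≤ Phi f g x := by
  have h1 := h.isMinimizer_yStar x y
  rw [h.avgFun_eq, h.avgFun_eq] at h1
  exact neg_le_neg_iff.1 h1

theorem isGreatest_Phi (h : StronglyConcaveFamily f g L μ) (x : Vec n) :
    IsGreatest (Set.range (avgFun f x)) (Phi f g x) :=
  ⟨⟨_, rfl⟩, by rintro _ ⟨y, rfl⟩; exact h.avgFun_le_Phi x y⟩

theorem norm_gradX_sub_le (h : StronglyConcaveFamily f g L μ) (x : Vec n) (y y' : Vec r) :
    ‖gradX (avgFun f) x y - gradX (avgFun f) x y'‖ ≤ L * ‖y - y'‖ := by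
  refine le_mul_of_sq_le h.L_pos.le (norm_nonneg _) ?_
  simpa using h.smooth_avg_f.gradX_sub_sq_le x x y y'

theorem abs_avgFun_sub_le (h : StronglyConcaveFamily f g L μ) (x x' : Vec n) (y : Vec r) :
    |avgFun f x' y - avgFun f x y - ⟪gradX (avgFun f) x y, x' - x⟫| ≤ L * ‖x' - x‖ ^ 2 :=
  abs_sub_sub_inner_le (φ := fun x => avgFun f x y) (v := fun x => gradX (avgFun f) x y) h.L_pos.le
    (fun x => h.smooth_avg_f.hasGradientAt_left x y)
    (fun x x' => le_mul_of_sq_le h.L_pos.le (norm_nonneg _) (by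
      simpa using h.smooth_avg_f.gradX_sub_sq_le x x' y y)) x x'

/-- Quadratic control of the first-order Taylor remainder of `Φ` (Danskin's theorem). -/
theorem abs_Phi_sub_le (h : StronglyConcaveFamily f g L μ) (x x' : Vec n) :
    |Phi f g x' - Phi f g x - ⟪gradX (avgFun f) x (yStar g x), x' - x⟫|
      ≤ (L + L * (L / μ)) * ‖x' - x‖ ^ 2 := by
  set y := yStar g x with hy
  set y' := yStar g x' with hy'
  have hx : Phi f g x = avgFun f x y := rfl
  have hx' : Phi f g x' = avgFun f x' y' := rfl
  have h1 := abs_le.1 (h.abs_avgFun_sub_le x x' y)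
  have h2 := abs_le.1 (h.abs_avgFun_sub_le x x' y')
  have h3 := h.avgFun_le_Phi x y'
  have h4 := h.avgFun_le_Phi x' y
  have h5 : ⟪gradX (avgFun f) x y', x' - x⟫ - ⟪gradX (avgFun f) x y, x' - x⟫
      ≤ L * (L / μ) * ‖x' - x‖ ^ 2 := by
    rw [← inner_sub_left]
    refine (real_inner_le_norm _ _).trans ?_
    have h6 := (h.norm_gradX_sub_le x y' y).trans
      (mul_le_mul_of_nonneg_left (h.yStar_lipschitz x' x) h.L_pos.le)
    calc _ ≤ L * (L / μ * ‖x' - x‖) * ‖x' - x‖ := by gcongr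
      _ = _ := by ring
  have hnn : 0 ≤ L * (L / μ) * ‖x' - x‖ ^ 2 := by
    have := h.L_pos; have := h.μ_pos; positivity
  rw [abs_le]
  constructor <;> linarith [h1.1, h2.2]

theorem hasGradientAt_Phi (h : StronglyConcaveFamily f g L μ) (x : Vec n) :
    HasGradientAt (Phi f g) (gradX (avgFun f) x (yStar g x)) x := by
  rw [hasGradientAt_iff_isLittleO]
  have hO : (fun x' => Phi f g x' - Phi f g x - ⟪gradX (avgFun f) x (yStar g x), x' - x⟫)
      =O[𝓝 x] fun x' => ‖x' - x‖ ^ 2 :=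
    Asymptotics.IsBigO.of_bound _ (Filter.Eventually.of_forall fun x' => by
      simpa using h.abs_Phi_sub_le x x')
  refine hO.trans_isLittleO ?_
  exact Asymptotics.isLittleO_pow_sub_sub x one_lt_two

/-! ### Exactness of the penalty problem -/

/-- Source of all exactness claims: f = -g merges the objective and the penalty into one multiple of
the inner optimality gap. -/
theorem penalty_eq (h : StronglyConcaveFamily f g L μ) (lam : ℝ) (x : Vec n) (y : Vec r) :
    penalty f g lam x y
      = Phi f g x + (lam - 1) * (avgFun g x y - avgFun g x (yStar g x)) := by
  have h1 : penalty f g lam x y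
      = avgFun f x y + lam * (avgFun g x y - avgFun g x (yStar g x)) := by
    unfold penalty
    rw [avg_add, avg_mul, avg_sub]
    rfl
  rw [h1]
  simp only [h.avgFun_eq, Phi]
  ring

theorem penalty_yStar (h : StronglyConcaveFamily f g L μ) (lam : ℝ) (x : Vec n) :
    penalty f g lam x (yStar g x) = Phi f g x := by
  rw [h.penalty_eq, sub_self, mul_zero, add_zero]

theorem Phi_le_penalty (h : StronglyConcaveFamily f g L μ) {lam : ℝ} (hl : 1 ≤ lam) (x : Vec n)
    (y : Vec r) : Phi f g x ≤ penalty f g lam x y := by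
  rw [h.penalty_eq]
  exact le_add_of_nonneg_right
    (mul_nonneg (sub_nonneg.2 hl) (sub_nonneg.2 (h.isMinimizer_yStar x y)))

theorem isMinimizer_penalty_yStar (h : StronglyConcaveFamily f g L μ) {lam : ℝ} (hl : 1 ≤ lam)
    (x : Vec n) : IsMinimizer (penalty f g lam x) (yStar g x) := fun y => by
  rw [h.penalty_yStar]
  exact h.Phi_le_penalty hl x y

theorem isMinimizer_penalty_yPen (h : StronglyConcaveFamily f g L μ) {lam : ℝ} (hl : 1 ≤ lam)
    (x : Vec n) : IsMinimizer (penalty f g lam x) (yPen f g lam x) :=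
  Classical.epsilon_spec ⟨_, h.isMinimizer_penalty_yStar hl x⟩

theorem eq_yStar_of_penalty_le (h : StronglyConcaveFamily f g L μ) {lam : ℝ} (hl : 1 < lam)
    {x : Vec n} {y : Vec r} (hy : penalty f g lam x y ≤ Phi f g x) : y = yStar g x := by
  rw [h.penalty_eq] at hy
  refine (h.isMinimizer_iff x y).1 fun y' => ?_
  refine le_trans ?_ (h.isMinimizer_yStar x y')
  have h1 : (lam - 1) * (avgFun g x y - avgFun g x (yStar g x)) ≤ 0 := by linarith
  by_contra hc
  push Not at hc
  have := mul_pos (sub_pos.2 hl) (sub_pos.2 hc)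
  linarith

theorem isMinimizer_penalty_iff (h : StronglyConcaveFamily f g L μ) {lam : ℝ} (hl : 1 < lam)
    (x : Vec n) (y : Vec r) : IsMinimizer (penalty f g lam x) y ↔ y = yStar g x := by
  refine ⟨fun hy => h.eq_yStar_of_penalty_le hl ?_,
    fun hy => hy ▸ h.isMinimizer_penalty_yStar hl.le x⟩
  rw [← h.penalty_yStar lam]
  exact hy _

theorem pStar_eq (h : StronglyConcaveFamily f g L μ) {lam : ℝ} (hl : 1 ≤ lam) :
    pStar f g lam = Phi f g := by
  funext x
  refine le_antisymm ?_ (h.Phi_le_penalty hl x _)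
  rw [← h.penalty_yStar lam]
  exact h.isMinimizer_penalty_yPen hl x _

theorem isMinMaxSol_iff (h : StronglyConcaveFamily f g L μ) (x : Vec n) (y : Vec r) :
    IsMinMaxSol (avgFun f) x y ↔ y = yStar g x ∧ ∀ x', Phi f g x ≤ Phi f g x' := by
  constructor
  · rintro ⟨h1, h2⟩
    have hy : y = yStar g x := (h.isMinimizer_iff x y).1 fun y' => by
      rw [h.avgFun_eq, h.avgFun_eq]
      exact neg_le_neg (h1 y')
    subst hy
    exact ⟨rfl, fun x' => h2 x' _ (h.isGreatest_Phi x')⟩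
  · rintro ⟨rfl, h2⟩
    refine ⟨h.avgFun_le_Phi x, fun x' v hv => ?_⟩
    rw [hv.unique (h.isGreatest_Phi x')]
    exact h2 x'

theorem isGLB_iff (h : StronglyConcaveFamily f g L μ) {lam : ℝ} (hl : 1 ≤ lam) (v : ℝ) :
    IsGLB (Set.range (Phi f g)) v ↔
      IsGLB (Set.range fun q : Vec n × Vec r => penalty f g lam q.1 q.2) v := by
  have hb : lowerBounds (Set.range (Phi f g))
      = lowerBounds (Set.range fun q : Vec n × Vec r => penalty f g lam q.1 q.2) := by
    ext w
    constructor
    · rintro hw _ ⟨q, rfl⟩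
      exact (hw ⟨q.1, rfl⟩).trans (h.Phi_le_penalty hl _ _)
    · rintro hw _ ⟨x, rfl⟩
      rw [← h.penalty_yStar lam]
      exact hw ⟨(x, yStar g x), rfl⟩
  rw [IsGLB, IsGLB, hb]

theorem isMinimizer_penalty_of_isMinMaxSol (h : StronglyConcaveFamily f g L μ) {lam : ℝ}
    (hl : 1 ≤ lam) {x : Vec n} {y : Vec r} (hxy : IsMinMaxSol (avgFun f) x y) :
    IsMinimizer (fun q : Vec n × Vec r => penalty f g lam q.1 q.2) (x, y) := by
  obtain ⟨rfl, h2⟩ := (h.isMinMaxSol_iff x y).1 hxy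
  intro q
  simp only [h.penalty_yStar]
  exact (h2 q.1).trans (h.Phi_le_penalty hl _ _)

theorem isMinMaxSol_of_isMinimizer_penalty (h : StronglyConcaveFamily f g L μ) {lam : ℝ}
    (hl : 1 ≤ lam) {x : Vec n} {y : Vec r}
    (hxy : IsMinimizer (fun q : Vec n × Vec r => penalty f g lam q.1 q.2) (x, y)) :
    IsMinMaxSol (avgFun f) x (yStar g x) ∧ (1 < lam → IsMinMaxSol (avgFun f) x y) := by
  have h1 : ∀ x', penalty f g lam x y ≤ Phi f g x' := fun x' => by
    rw [← h.penalty_yStar lam]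
    exact hxy (x', yStar g x')
  have h2 : IsMinMaxSol (avgFun f) x (yStar g x) :=
    (h.isMinMaxSol_iff _ _).2 ⟨rfl, fun x' => (h.Phi_le_penalty hl x y).trans (h1 x')⟩
  refine ⟨h2, fun hl' => ?_⟩
  rwa [h.eq_yStar_of_penalty_le hl' (h1 x)]

end StronglyConcaveFamily

/-! ### Error measures and one-step estimates for AHEAD -/

/-- Consensus error `(1/m) ∑ᵢ ‖vᵢ - v̄‖²`. -/
noncomputable def consensusError {m d : ℕ} (v : Fin m → Vec d) : ℝ :=
  avg fun i => ‖v i - avg v‖ ^ 2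

/-- Squared distance of the average of `v` to the inner solution at the average of `x`. -/
noncomputable def innerError {m n r : ℕ} (g : Fin m → Vec n → Vec r → ℝ) (x : Fin m → Vec n)
    (v : Fin m → Vec r) : ℝ :=
  ‖avg v - yStar g (avg x)‖ ^ 2

/-- Direction used by node `i` to update its outer variable. -/
noncomputable def outerDir {m n r : ℕ} (f g : Fin m → Vec n → Vec r → ℝ) (lam : ℝ)
    (s : State m n r) (i : Fin m) : Vec n :=
  gradX (f i) (s.x i) (s.y i) + lam • (gradX (g i) (s.x i) (s.y i) - gradX (g i) (s.x i) (s.z i))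

/-- Bound on the deviation of the outer directions from the gradients at the averaged iterate. -/
noncomputable def outerErrorBound {m n r : ℕ} (g : Fin m → Vec n → Vec r → ℝ) (L lam : ℝ)
    (s : State m n r) : ℝ :=
  2 * L ^ 2 * (2 * lam ^ 2 * consensusError s.x
    + (lam - 1) ^ 2 * (consensusError s.y + innerError g s.x s.y)
    + lam ^ 2 * (consensusError s.z + innerError g s.x s.z))

theorem consensusError_nonneg {m d : ℕ} (v : Fin m → Vec d) : 0 ≤ consensusError v :=
  avg_nonneg fun i => by positivity

theorem innerError_nonneg {m n r : ℕ} (g : Fin m → Vec n → Vec r → ℝ) (x : Fin m → Vec n)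
    (v : Fin m → Vec r) : 0 ≤ innerError g x v := by
  unfold innerError; positivity

namespace StronglyConcaveFamily

variable {m n r : ℕ} {f g : Fin m → Vec n → Vec r → ℝ} {L μ : ℝ}

/-- A unit vector, available since r ≥ 1, compares strong monotonicity with the Lipschitz bound.
This gives κ ≥ 1. -/
theorem mu_le_L (h : StronglyConcaveFamily f g L μ) (hr : 0 < r) : μ ≤ L := by
  set y : Vec r := EuclideanSpace.single ⟨0, hr⟩ 1 with hy
  have hn : ‖y‖ = 1 := by simp [hy]
  have h1 := h.inner_gradY_sub_ge 0 y 0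
  have h2 := real_inner_le_norm (gradY (avgFun g) 0 y - gradY (avgFun g) 0 0) (y - 0)
  have h3 : ‖gradY (avgFun g) 0 y - gradY (avgFun g) 0 0‖ ≤ L * ‖y - 0‖ := by
    refine le_mul_of_sq_le h.L_pos.le (norm_nonneg _) ?_
    simpa using h.smooth_avg_g.gradY_sub_sq_le 0 0 y 0
  simp only [sub_zero, hn] at h1 h2 h3
  linarith

theorem avg_dist_yStar (h : StronglyConcaveFamily f g L μ) (x : Fin m → Vec n)
    (v : Fin m → Vec r) :
    avg (fun i => ‖v i - yStar g (avg x)‖ ^ 2) = consensusError v + innerError g x v :=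
  avg_norm_sub_sq h.m_pos v _

/-- The direction is an affine combination, with weights -(λ-1) and λ, of gradients of fᵢ at (xᵢ,yᵢ)
and (xᵢ,zᵢ), so the reference gradient can be subtracted inside each term. The factor (λ-1)² on the
y-errors is kept because these are not controlled when λ = 1. -/
theorem avg_outerDir_sub_sq_le (h : StronglyConcaveFamily f g L μ) {lam : ℝ} (hl : 1 ≤ lam)
    (s : State m n r) :
    avg (fun i => ‖outerDir f g lam s i - gradX (f i) (avg s.x) (yStar g (avg s.x))‖ ^ 2)
      ≤ outerErrorBound g L lam s := by
  set y := yStar g (avg s.x) with hy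
  have hp : ∀ i, ‖outerDir f g lam s i - gradX (f i) (avg s.x) y‖ ^ 2
      ≤ 2 * L ^ 2 * (lam - 1) ^ 2 * (‖s.x i - avg s.x‖ ^ 2 + ‖s.y i - y‖ ^ 2)
        + 2 * L ^ 2 * lam ^ 2 * (‖s.x i - avg s.x‖ ^ 2 + ‖s.z i - y‖ ^ 2) := fun i => by
    have h1 : outerDir f g lam s i - gradX (f i) (avg s.x) y
        = (-(lam - 1)) • (gradX (f i) (s.x i) (s.y i) - gradX (f i) (avg s.x) y)
          + lam • (gradX (f i) (s.x i) (s.z i) - gradX (f i) (avg s.x) y) := by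
      unfold outerDir
      rw [h.gradX_eq, h.gradX_eq]
      module
    rw [h1]
    refine (norm_add_sq_le_two _ _).trans ?_
    rw [norm_smul, norm_smul, mul_pow, mul_pow, Real.norm_eq_abs, Real.norm_eq_abs, sq_abs,
      sq_abs, neg_sq]
    have h2 := mul_le_mul_of_nonneg_left
      ((h.smooth_f i).gradX_sub_sq_le (s.x i) (avg s.x) (s.y i) y) (sq_nonneg (lam - 1))
    have h3 := mul_le_mul_of_nonneg_left
      ((h.smooth_f i).gradX_sub_sq_le (s.x i) (avg s.x) (s.z i) y) (sq_nonneg lam)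
    linarith
  refine (avg_mono hp).trans ?_
  rw [avg_add, avg_mul, avg_mul, avg_add, avg_add, h.avg_dist_yStar, h.avg_dist_yStar]
  have hX := consensusError_nonneg s.x
  change 2 * L ^ 2 * (lam - 1) ^ 2 * (consensusError s.x + _)
    + 2 * L ^ 2 * lam ^ 2 * (consensusError s.x + _) ≤ _
  have hs : (lam - 1) ^ 2 ≤ lam ^ 2 := pow_le_pow_left₀ (by linarith) (by linarith) 2
  have h4 : L ^ 2 * ((lam - 1) ^ 2 * consensusError s.x) ≤ L ^ 2 * (lam ^ 2 * consensusError s.x) :=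
    mul_le_mul_of_nonneg_left (mul_le_mul_of_nonneg_right hs hX) (sq_nonneg L)
  unfold outerErrorBound
  linarith

theorem norm_avg_outerDir_sub_sq_le (h : StronglyConcaveFamily f g L μ) {lam : ℝ} (hl : 1 ≤ lam)
    (s : State m n r) :
    ‖avg (outerDir f g lam s) - gradX (avgFun f) (avg s.x) (yStar g (avg s.x))‖ ^ 2
      ≤ outerErrorBound g L lam s := by
  rw [gradX_avgFun h.smooth_f, ← avg_sub]
  exact (norm_avg_sq_le h.m_pos _).trans (h.avg_outerDir_sub_sq_le hl s)

theorem consensusError_outerDir_le (h : StronglyConcaveFamily f g L μ) {lam b : ℝ}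
    (hl : 1 ≤ lam) (hb : BoundedHeterogeneity f g b) (s : State m n r) :
    consensusError (outerDir f g lam s) ≤ 2 * b ^ 2 + 2 * outerErrorBound g L lam s := by
  refine (avg_dispersion_le_of_near h.m_pos _
    fun i => gradX (f i) (avg s.x) (yStar g (avg s.x))).trans ?_
  have h1 := hb.gradX_le (avg s.x)
  rw [gradX_avgFun h.smooth_f] at h1
  linarith [h.avg_outerDir_sub_sq_le hl s]

theorem avg_gradY_sub_sq_le (h : StronglyConcaveFamily f g L μ) (x : Fin m → Vec n)
    (v : Fin m → Vec r) (w : Vec r) :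
    avg (fun i => ‖gradY (g i) (x i) (v i) - gradY (g i) (avg x) w‖ ^ 2)
      ≤ L ^ 2 * (consensusError x + avg fun i => ‖v i - w‖ ^ 2) := by
  refine (avg_mono fun i => (h.smooth_g i).gradY_sub_sq_le (x i) (avg x) (v i) w).trans_eq ?_
  rw [avg_mul, avg_add]
  rfl

theorem consensusError_gradY_le (h : StronglyConcaveFamily f g L μ) {b : ℝ}
    (hb : BoundedHeterogeneity f g b) (x : Fin m → Vec n) (v : Fin m → Vec r) :
    consensusError (fun i => gradY (g i) (x i) (v i))
      ≤ 2 * b ^ 2 + 2 * (L ^ 2 * (consensusError x + consensusError v + innerError g x v)) := by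
  set y := yStar g (avg x) with hy
  refine (avg_dispersion_le_of_near h.m_pos _ fun i => gradY (g i) (avg x) y).trans ?_
  have h1 := hb.gradY_le (avg x)
  rw [gradY_avgFun h.smooth_f, ← hy] at h1
  have h2 : avg (fun i => ‖gradY (g i) (avg x) y - avg (fun i => gradY (g i) (avg x) y)‖ ^ 2)
      ≤ b ^ 2 := by
    refine le_trans (le_of_eq ?_) h1
    congr 1
    funext i
    simp only [h.gradY_eq]
    rw [avg_neg, ← neg_sub', norm_neg]
  have h3 := h.avg_gradY_sub_sq_le x v y
  rw [hy, h.avg_dist_yStar, ← add_assoc] at h3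
  linarith

/-- Contraction of the error of an averaged inner gradient step, while the outer variable moves
by `a • d`. -/
theorem innerError_step (h : StronglyConcaveFamily f g L μ) {t a : ℝ} (ht : 0 ≤ t)
    (ht1 : t * L ^ 2 ≤ μ / 2) (ht2 : t * μ ≤ 1) (x x' : Fin m → Vec n) (v v' : Fin m → Vec r)
    (d : Vec n) (hx' : avg x' = avg x - a • d)
    (hv' : avg v' = avg v - t • avg (fun i => gradY (g i) (x i) (v i))) :
    t * μ * innerError g x' v' + (t * μ) ^ 2 * innerError g x v
      ≤ t * μ * innerError g x v + 6 * ((t * L) ^ 2 * (consensusError x + consensusError v)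
        + (L / μ * a) ^ 2 * ‖d‖ ^ 2) := by
  -- t = 0 occurs for the y-variable when λ = 1. Multiplying the recursion by tμ makes it meaningful
  -- there.
  rcases ht.eq_or_lt with rfl | ht
  · have hd : 0 ≤ (L / μ * a) ^ 2 * ‖d‖ ^ 2 := by positivity
    linarith
  have hμ := h.μ_pos
  -- p is the error after an exact gradient step on g(x̄,·); q collects the gradient error due to
  -- lack of consensus and the drift of y*.
  set y := yStar g (avg x) with hy
  set G := gradY (avgFun g) (avg x) (avg v) with hG
  set p := avg v - t • G - y with hp
  set q := t • (G - avg (fun i => gradY (g i) (x i) (v i))) + (y - yStar g (avg x')) with hq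
  have he0 := innerError_nonneg g x v
  have hsum : innerError g x' v' = ‖p + q‖ ^ 2 := by
    unfold innerError
    rw [hv', hp, hq]
    congr 2
    module
  have hpsq : ‖p‖ ^ 2 ≤ (1 - 3 / 2 * (t * μ)) * innerError g x v := by
    have h1 : μ * ‖avg v - y‖ ^ 2 ≤ ⟪G, avg v - y⟫ := by
      have := h.inner_gradY_sub_ge (avg x) (avg v) y
      rwa [h.gradY_yStar, sub_zero] at this
    have h2 : ‖G‖ ^ 2 ≤ L ^ 2 * ‖avg v - y‖ ^ 2 := by
      have := h.smooth_avg_g.gradY_sub_sq_le (avg x) (avg x) (avg v) y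
      rw [h.gradY_yStar, sub_zero, sub_self] at this
      simpa using this
    have h3 : p = (avg v - y) - t • G := by rw [hp]; abel
    rw [h3, norm_sub_sq_real, inner_smul_right, norm_smul, mul_pow, Real.norm_eq_abs, sq_abs,
      real_inner_comm]
    change ‖avg v - y‖ ^ 2 - 2 * (t * ⟪G, avg v - y⟫) + t ^ 2 * ‖G‖ ^ 2
      ≤ (1 - 3 / 2 * (t * μ)) * ‖avg v - y‖ ^ 2
    have h4 : t ^ 2 * ‖G‖ ^ 2 ≤ t * (μ / 2) * ‖avg v - y‖ ^ 2 := by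
      calc t ^ 2 * ‖G‖ ^ 2 ≤ t ^ 2 * (L ^ 2 * ‖avg v - y‖ ^ 2) := by gcongr
        _ = t * (t * L ^ 2) * ‖avg v - y‖ ^ 2 := by ring
        _ ≤ _ := by gcongr
    have h5 := mul_le_mul_of_nonneg_left h1 ht.le
    linarith
  have hqsq : ‖q‖ ^ 2 ≤ 2 * ((t * L) ^ 2 * (consensusError x + consensusError v))
      + 2 * ((L / μ * a) ^ 2 * ‖d‖ ^ 2) := by
    refine (norm_add_sq_le_two _ _).trans ?_
    have h1 : ‖G - avg (fun i => gradY (g i) (x i) (v i))‖ ^ 2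
        ≤ L ^ 2 * (consensusError x + consensusError v) := by
      rw [hG, gradY_avgFun h.smooth_g, norm_sub_rev, ← avg_sub]
      exact (norm_avg_sq_le h.m_pos _).trans (h.avg_gradY_sub_sq_le x v (avg v))
    have h2 : ‖y - yStar g (avg x')‖ ^ 2 ≤ (L / μ * a) ^ 2 * ‖d‖ ^ 2 := by
      have := pow_le_pow_left₀ (norm_nonneg _) (h.yStar_lipschitz (avg x) (avg x')) 2
      rw [hx', sub_sub_cancel, norm_smul, mul_pow, mul_pow, Real.norm_eq_abs, sq_abs] at this
      rw [hx', hy]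
      linarith
    rw [norm_smul, mul_pow, Real.norm_eq_abs, sq_abs]
    have h3 := mul_le_mul_of_nonneg_left h1 (sq_nonneg t)
    rw [mul_pow t L]
    linarith
  have hτ : 0 < t * μ := mul_pos ht hμ
  -- With τ = tμ and η = τ/2, (1+τ/2)(1-3τ/2) ≤ 1-τ, while the factor 1+2/τ of ‖q‖² becomes τ+2 ≤ 3
  -- after multiplication by τ.
  have hy' := norm_add_sq_le_young (half_pos hτ) p q
  rw [hsum]
  have h1 : t * μ * ‖p + q‖ ^ 2
      ≤ t * μ * ((1 + t * μ / 2) * ‖p‖ ^ 2) + (t * μ + 2) * ‖q‖ ^ 2 := by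
    refine (mul_le_mul_of_nonneg_left hy' hτ.le).trans_eq ?_
    field_simp
  have h2 : t * μ * ((1 + t * μ / 2) * ‖p‖ ^ 2) ≤ t * μ * ((1 - t * μ) * innerError g x v) := by
    refine mul_le_mul_of_nonneg_left ?_ hτ.le
    calc _ ≤ (1 + t * μ / 2) * ((1 - 3 / 2 * (t * μ)) * innerError g x v) := by gcongr
      _ ≤ _ := by
        rw [← mul_assoc]
        refine mul_le_mul_of_nonneg_right ?_ he0
        nlinarith
  have h3 : (t * μ + 2) * ‖q‖ ^ 2 ≤ 3 * ‖q‖ ^ 2 := by gcongr; linarith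
  linarith

/-- ∇_y fᵢ + λ∇_y gᵢ = (λ-1)∇_y gᵢ, so y obeys the recursion of z with step β(λ-1). -/
theorem aheadStep_y (h : StronglyConcaveFamily f g L μ) (s : State m n r)
    (W : Matrix (Fin m) (Fin m) ℝ) (lam α β γ : ℝ) :
    (aheadStep f g W lam α β γ s).y
      = fun i => mix W s.y i - (β * (lam - 1)) • gradY (g i) (s.x i) (s.y i) := by
  funext i
  simp only [aheadStep]
  rw [h.gradY_eq]
  module

/-- Descent of `Φ` along a step in the direction `d`. -/
theorem Phi_step (h : StronglyConcaveFamily f g L μ) {a : ℝ} (ha : 0 ≤ a)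
    (ha' : a * (L + L * (L / μ)) ≤ 1 / 4) (x d : Vec n) :
    Phi f g (x - a • d) + (a / 2 * ‖gradient (Phi f g) x‖ ^ 2 + a / 4 * ‖d‖ ^ 2)
      ≤ Phi f g x + a / 2 * ‖d - gradX (avgFun f) x (yStar g x)‖ ^ 2 := by
  rw [(h.hasGradientAt_Phi x).gradient]
  set v := gradX (avgFun f) x (yStar g x)
  have h1 := (abs_le.1 (h.abs_Phi_sub_le x (x - a • d))).2
  have h2 : x - a • d - x = -(a • d) := by abel
  rw [h2, inner_neg_right, inner_smul_right, norm_neg, norm_smul, mul_pow, Real.norm_eq_abs,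
    sq_abs] at h1
  -- Polarization turns -a⟪v,d⟫ into -a/2 (‖v‖² + ‖d‖² - ‖d-v‖²). The Taylor remainder uses half of
  -- the ‖d‖² term; the rest later pays for the drift of y*.
  have h3 : ‖d - v‖ ^ 2 = ‖d‖ ^ 2 - 2 * ⟪v, d⟫ + ‖v‖ ^ 2 := by
    rw [norm_sub_sq_real, real_inner_comm]
  have h4 : (L + L * (L / μ)) * (a ^ 2 * ‖d‖ ^ 2) ≤ a * (1 / 4) * ‖d‖ ^ 2 := by
    calc _ = a * (a * (L + L * (L / μ))) * ‖d‖ ^ 2 := by ring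
      _ ≤ _ := by gcongr
  rw [h3]
  change _ - _ - -(a * ⟪v, d⟫) ≤ _ at h1
  nlinarith

end StronglyConcaveFamily

/-! ### Summed recursions -/

/-- Only tμ is cancelled: σ stands for λ-1, which may be 0, and the weight σ² is the one with which
U enters the outer error. -/
theorem weighted_inner_sum_le {t μ k σ D E G U : ℝ} (ht : 0 < t) (hμ : 0 < μ)
    (h : (t * σ * μ) ^ 2 * U ≤ t * σ * μ * D + 6 * ((t * σ * (k * μ)) ^ 2 * E + G)) :
    σ ^ 2 * U ≤ σ * D / (t * μ) + 6 * (k ^ 2 * σ ^ 2 * E + G / (t * μ) ^ 2) := by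
  have e : σ * D / (t * μ) + 6 * (k ^ 2 * σ ^ 2 * E + G / (t * μ) ^ 2)
      = (t * σ * μ * D + 6 * ((t * σ * (k * μ)) ^ 2 * E + G)) / (t * μ) ^ 2 := by
    field_simp
  rw [e, le_div_iff₀ (by positivity)]
  linarith

set_option maxHeartbeats 1000000 in
/-- Resolution of the coupled summed recursions: `X, Y, Z` are the summed consensus errors, `U, V`
the summed inner errors, `A` the summed squared gradients and `S` the summed squared directions. -/
theorem sum_gradient_sq_le_of_recursions
    {L k μ s lam δ α β γ D B X Y Z U V A S R : ℝ}
    (hL : 0 < L) (hk : 1 ≤ k) (hμ : 0 < μ) (hs : 0 ≤ s) (hlam : 1 ≤ lam) (hsl : s ≤ lam) (hδ : 0 < δ)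
    (hα : 0 < α) (hβ : 0 < β) (hγ : 0 < γ)
    (hX0 : 0 ≤ X) (hY0 : 0 ≤ Y) (hZ0 : 0 ≤ Z) (hU0 : 0 ≤ U) (hV0 : 0 ≤ V)
    (hS0 : 0 ≤ S) (hD : 0 ≤ D) (hB : 0 ≤ B)
    (hR : R = 2 * L ^ 2 * (2 * lam ^ 2 * X + s ^ 2 * (Y + U) + lam ^ 2 * (Z + V)))
    (hX : δ / 2 * X ≤ D + 3 / δ * α ^ 2 * (2 * B + 2 * R))
    (hY : δ / 2 * Y ≤ D + 3 / δ * (β * s) ^ 2 * (2 * B + 2 * (L ^ 2 * (X + Y + U))))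
    (hZ : δ / 2 * Z ≤ D + 3 / δ * γ ^ 2 * (2 * B + 2 * (L ^ 2 * (X + Z + V))))
    (hU : (β * s * μ) ^ 2 * U
      ≤ β * s * μ * D + 6 * ((β * s * L) ^ 2 * (X + Y) + (k * α) ^ 2 * S))
    (hV : (γ * μ) ^ 2 * V ≤ γ * μ * D + 6 * ((γ * L) ^ 2 * (X + Z) + (k * α) ^ 2 * S))
    (hA : α / 2 * A + α / 4 * S ≤ D + α / 2 * R)
    (hkL : k * μ = L)
    (hsx : lam * α * k * L ≤ δ / 200) (hsy : β * s * k * L ≤ δ / 200) (hsz : γ * k * L ≤ δ / 200)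
    (hdu : k * α * L ≤ β * μ / 80) (hdv : k * α * L * lam ≤ γ * μ / 32) :
    A ≤ 2 * D / α + 500 * (L ^ 2 * (k ^ 2 * lam ^ 2 * D / δ + s * D / (β * μ)
      + lam ^ 2 * D / (γ * μ)
      + (k * lam * α / δ) ^ 2 * B + (k * s * (β * s) / δ) ^ 2 * B + (k * lam * γ / δ) ^ 2 * B)) := by
  have hk0 : 0 < k := by linarith
  have hk2 : 1 ≤ k ^ 2 := one_le_pow₀ hk
  have hl0 : 0 < lam := by linarith
  have small : ∀ {t : ℝ}, 0 ≤ t → t * L ≤ δ / 200 → 12 / δ ^ 2 * (t ^ 2 * L ^ 2) ≤ 3 / 10000 := by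
    intro t ht h
    have h1 : (t * L) ^ 2 ≤ (δ / 200) ^ 2 := pow_le_pow_left₀ (by positivity) h 2
    rw [← mul_pow, div_mul_eq_mul_div, div_le_iff₀ (by positivity)]
    nlinarith
  -- consensus sums
  have solve : ∀ {E t H w : ℝ}, δ / 2 * E ≤ D + 3 / δ * t ^ 2 * (2 * B + 2 * H) →
      0 ≤ w → w ^ 2 * E ≤ 2 * (w ^ 2 * D / δ) + 12 * ((w * t / δ) ^ 2 * B)
        + 12 / δ ^ 2 * (w * t) ^ 2 * H := by
    intro E t H w h hw
    have h1 := mul_le_mul_of_nonneg_left h (show 0 ≤ w ^ 2 * (2 / δ) by positivity)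
    have e1 : w ^ 2 * (2 / δ) * (δ / 2 * E) = w ^ 2 * E := by field_simp
    rw [e1] at h1
    refine h1.trans_eq ?_
    field_simp
    ring
  -- The extra factor k² = (L/μ)² is the one with which consensus errors enter the inner sums. Here
  -- ρ is the rescaled outer error, not the network constant.
  set P := (k * lam) ^ 2 * X with hP
  set Q := (k * s) ^ 2 * Y with hQ
  set T := (k * lam) ^ 2 * Z with hT
  set U' := s ^ 2 * U with hU'
  set V' := lam ^ 2 * V with hV'
  set ρ := R / L ^ 2 with hρ
  have hRρ : R = L ^ 2 * ρ := by rw [hρ]; field_simp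
  have hP0 : 0 ≤ P := by positivity
  have hQ0 : 0 ≤ Q := by positivity
  have hT0 : 0 ≤ T := by positivity
  have hU0' : 0 ≤ U' := by positivity
  have hV0' : 0 ≤ V' := by positivity
  have hXP : lam ^ 2 * X ≤ P := by
    rw [hP, mul_pow, mul_assoc]
    exact le_mul_of_one_le_left (by positivity) hk2
  have hYQ : s ^ 2 * Y ≤ Q := by
    rw [hQ, mul_pow, mul_assoc]
    exact le_mul_of_one_le_left (by positivity) hk2
  have hZT : lam ^ 2 * Z ≤ T := by
    rw [hT, mul_pow, mul_assoc]
    exact le_mul_of_one_le_left (by positivity) hk2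
  have hsX : s ^ 2 * X ≤ lam ^ 2 * X :=
    mul_le_mul_of_nonneg_right (pow_le_pow_left₀ hs hsl 2) hX0
  have hρe : ρ = 2 * (2 * (lam ^ 2 * X) + (s ^ 2 * Y + U') + (lam ^ 2 * Z + V')) := by
    rw [hρ, hR, hU', hV']
    field_simp
  have hρ0 : 0 ≤ ρ := by rw [hρe]; positivity
  have hP' : P ≤ 2 * ((k * lam) ^ 2 * D / δ) + 12 * ((k * lam * α / δ) ^ 2 * B)
      + 3 / 10000 * ρ := by
    refine (solve hX (by positivity)).trans (add_le_add_right ?_ _)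
    rw [hRρ, ← mul_assoc, mul_assoc (12 / δ ^ 2)]
    exact mul_le_mul_of_nonneg_right (small (by positivity) (by linarith)) hρ0
  have hQ' : Q ≤ 2 * ((k * s) ^ 2 * D / δ) + 12 * ((k * s * (β * s) / δ) ^ 2 * B)
      + 3 / 10000 * (P + Q + U') := by
    refine (solve hY (by positivity)).trans (add_le_add_right ?_ _)
    calc _ = 12 / δ ^ 2 * ((β * s * k) ^ 2 * L ^ 2) * (s ^ 2 * X + s ^ 2 * Y + U') := by
          rw [hU']; ring
      _ ≤ 3 / 10000 * (s ^ 2 * X + s ^ 2 * Y + U') :=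
          mul_le_mul_of_nonneg_right (small (by positivity) hsy) (by positivity)
      _ ≤ _ := by linarith
  have hT' : T ≤ 2 * ((k * lam) ^ 2 * D / δ) + 12 * ((k * lam * γ / δ) ^ 2 * B)
      + 3 / 10000 * (P + T + V') := by
    refine (solve hZ (by positivity)).trans (add_le_add_right ?_ _)
    calc _ = 12 / δ ^ 2 * ((γ * k) ^ 2 * L ^ 2) * (lam ^ 2 * X + lam ^ 2 * Z + V') := by
          rw [hV']; ring
      _ ≤ 3 / 10000 * (lam ^ 2 * X + lam ^ 2 * Z + V') :=
          mul_le_mul_of_nonneg_right (small (by positivity) hsz) (by positivity)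
      _ ≤ _ := by linarith
  -- inner sums
  set S' := S / L ^ 2 with hS'
  have hS0' : 0 ≤ S' := by positivity
  have hSS : S = L ^ 2 * S' := by rw [hS']; field_simp
  have hUb : U' ≤ s * D / (β * μ) + 6 * (P + Q + S' / 6400) := by
    have h1 : (k * α) ^ 2 * S ≤ (β * μ) ^ 2 * (S' / 6400) := by
      rw [hSS]
      calc _ = (k * α * L) ^ 2 * S' := by ring
        _ ≤ (β * μ / 80) ^ 2 * S' := by gcongr
        _ = _ := by ring
    have h2 : (k * α) ^ 2 * S / (β * μ) ^ 2 ≤ S' / 6400 := by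
      rw [div_le_iff₀' (by positivity)]
      exact h1
    have h3 := weighted_inner_sum_le hβ hμ (hkL.symm ▸ hU)
    have h4 : k ^ 2 * (s ^ 2 * X) ≤ P := by
      rw [hP, mul_pow, mul_assoc]
      exact mul_le_mul_of_nonneg_left hsX (by positivity)
    have h5 : k ^ 2 * s ^ 2 * (X + Y) = k ^ 2 * (s ^ 2 * X) + Q := by rw [hQ]; ring
    rw [h5] at h3
    linarith
  have hVb : V' ≤ lam ^ 2 * D / (γ * μ) + 6 * (P + T + S' / 1024) := by
    have h1 : lam ^ 2 * ((k * α) ^ 2 * S) ≤ (γ * μ) ^ 2 * (S' / 1024) := by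
      rw [hSS]
      calc _ = (k * α * L * lam) ^ 2 * S' := by ring
        _ ≤ (γ * μ / 32) ^ 2 * S' := by gcongr
        _ = _ := by ring
    have h2 : lam ^ 2 * ((k * α) ^ 2 * S) / (γ * μ) ^ 2 ≤ S' / 1024 := by
      rw [div_le_iff₀' (by positivity)]
      exact h1
    have h3 := weighted_inner_sum_le (t := γ) (σ := 1) (k := k) (D := D) (E := X + Z)
      (G := (k * α) ^ 2 * S) (U := V) hγ hμ (by rw [mul_one, hkL]; exact hV)
    have h4 := mul_le_mul_of_nonneg_left h3 (sq_nonneg lam)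
    have h5 : lam ^ 2 * (1 * D / (γ * μ) + 6 * (k ^ 2 * 1 ^ 2 * (X + Z)
        + (k * α) ^ 2 * S / (γ * μ) ^ 2))
        = lam ^ 2 * D / (γ * μ) + 6 * (P + T + lam ^ 2 * ((k * α) ^ 2 * S) / (γ * μ) ^ 2) := by
      rw [hP, hT]; ring
    rw [h5] at h4
    linarith
  have hAb : A + S / 2 ≤ 2 * D / α + R := by
    refine le_of_mul_le_mul_left (a := α / 2) ?_ (by positivity)
    have e : α / 2 * (2 * D / α + R) = D + α / 2 * R := by field_simp
    rw [e]
    linarith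
  have hI : (k * s) ^ 2 * D / δ ≤ (k * lam) ^ 2 * D / δ := by gcongr
  have hb1 : 0 ≤ (k * lam * α / δ) ^ 2 * B := by positivity
  have hb2 : 0 ≤ (k * s * (β * s) / δ) ^ 2 * B := by positivity
  have hb3 : 0 ≤ (k * lam * γ / δ) ^ 2 * B := by positivity
  have hi1 : 0 ≤ (k * lam) ^ 2 * D / δ := by positivity
  have hi2 : 0 ≤ s * D / (β * μ) := by positivity
  have hi3 : 0 ≤ lam ^ 2 * D / (γ * μ) := by positivity
  -- The system closes linearly: P, Q, T return ρ with coefficients of order 3/10000, and U', V'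
  -- return S' with 6/6400 and 6/1024. The total stays below S'/2, exactly what `hAb` can absorb.
  have hρS : ρ ≤ S' / 2 + 500 * ((k * lam) ^ 2 * D / δ + s * D / (β * μ)
      + lam ^ 2 * D / (γ * μ) + (k * lam * α / δ) ^ 2 * B + (k * s * (β * s) / δ) ^ 2 * B
      + (k * lam * γ / δ) ^ 2 * B) := by
    linarith
  have hfin := mul_le_mul_of_nonneg_left hρS (sq_nonneg L)
  rw [← hRρ] at hfin
  rw [mul_pow k lam] at hfin
  linarith

/-! ### Summed recursions along the AHEAD trajectory -/

theorem ahead_succ {m n r : ℕ} (f g : Fin m → Vec n → Vec r → ℝ) (W : Matrix (Fin m) (Fin m) ℝ)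
    (lam α β γ : ℝ) (s₀ : State m n r) (k : ℕ) :
    ahead f g W lam α β γ s₀ (k + 1)
      = aheadStep f g W lam α β γ (ahead f g W lam α β γ s₀ k) :=
  Function.iterate_succ_apply' _ _ _

/-- Sum of the consensus errors of a sequence of perturbed mixing steps. -/
theorem NetworkAssumption.sum_consensusError_le {m d : ℕ} {G : SimpleGraph (Fin m)}
    {W : Matrix (Fin m) (Fin m) ℝ} (h : NetworkAssumption G W) (hρ : rho W < 1)
    {v u : ℕ → Fin m → Vec d} {t : ℝ} (hv : ∀ k, v (k + 1) = fun i => mix W (v k) i - t • u k i)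
    {b D : ℝ} {H : ℕ → ℝ} (hu : ∀ k, consensusError (u k) ≤ 2 * b + 2 * H k)
    (h0 : consensusError (v 0) ≤ D) (N : ℕ) :
    (1 - rho W) / 2 * ∑ k ∈ Finset.range N, consensusError (v k)
      ≤ D + 3 / (1 - rho W) * t ^ 2 * (2 * (N * b) + 2 * ∑ k ∈ Finset.range N, H k) := by
  have hδ : 0 < 1 - rho W := by linarith
  have hstep : ∀ k, consensusError (v (k + 1)) + (1 - rho W) / 2 * consensusError (v k)
      ≤ consensusError (v k) + 3 / (1 - rho W) * t ^ 2 * (2 * b + 2 * H k) := fun k => by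
    have h1 : consensusError (v (k + 1)) ≤ (1 + rho W) / 2 * consensusError (v k)
        + 3 / (1 - rho W) * t ^ 2 * consensusError (u k) := by
      rw [hv]
      exact h.consensus_step hρ (v k) (u k) t
    have h2 : 3 / (1 - rho W) * t ^ 2 * consensusError (u k)
        ≤ 3 / (1 - rho W) * t ^ 2 * (2 * b + 2 * H k) :=
      mul_le_mul_of_nonneg_left (hu k) (by positivity)
    linarith
  have hsum := sum_add_le_of_step (V := fun k => consensusError (v k)) hstep N
  rw [← Finset.mul_sum, ← Finset.mul_sum, Finset.sum_add_distrib, ← Finset.mul_sum] at hsum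
  simp only [Finset.sum_const, Finset.card_range, nsmul_eq_mul] at hsum
  rw [← Finset.mul_sum] at hsum
  linarith [consensusError_nonneg (v N)]

namespace StronglyConcaveFamily

variable {m n r : ℕ} {f g : Fin m → Vec n → Vec r → ℝ} {L μ : ℝ}

/-- Sum of the inner errors of a sequence of averaged inner gradient steps. -/
theorem sum_innerError_le (h : StronglyConcaveFamily f g L μ) {t a D : ℝ} (ht : 0 ≤ t)
    (ht1 : t * L ^ 2 ≤ μ / 2) (ht2 : t * μ ≤ 1) {x : ℕ → Fin m → Vec n} {v : ℕ → Fin m → Vec r}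
    {d : ℕ → Vec n} (hx : ∀ k, avg (x (k + 1)) = avg (x k) - a • d k)
    (hv : ∀ k, avg (v (k + 1)) = avg (v k) - t • avg (fun i => gradY (g i) (x k i) (v k i)))
    (h0 : innerError g (x 0) (v 0) ≤ D) (N : ℕ) :
    (t * μ) ^ 2 * ∑ k ∈ Finset.range N, innerError g (x k) (v k)
      ≤ t * μ * D + 6 * ((t * L) ^ 2 * (∑ k ∈ Finset.range N, consensusError (x k)
          + ∑ k ∈ Finset.range N, consensusError (v k))
        + (L / μ * a) ^ 2 * ∑ k ∈ Finset.range N, ‖d k‖ ^ 2) := by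
  have hsum := sum_add_le_of_step (V := fun k => t * μ * innerError g (x k) (v k))
    (fun k => h.innerError_step ht ht1 ht2 (x k) (x (k + 1)) (v k) (v (k + 1)) (d k) (hx k) (hv k))
    N
  simp only [← Finset.mul_sum, Finset.sum_add_distrib] at hsum
  have hμ := h.μ_pos
  have h1 : t * μ * innerError g (x 0) (v 0) ≤ t * μ * D := by gcongr
  have h2 : 0 ≤ t * μ * innerError g (x N) (v N) :=
    mul_nonneg (by positivity) (innerError_nonneg _ _ _)
  linarith

/-- Sum of the squared gradients of `Φ` along an AHEAD trajectory. -/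
theorem sum_gradient_sq_le (h : StronglyConcaveFamily f g L μ) (hr : 0 < r)
    {G : SimpleGraph (Fin m)} {W : Matrix (Fin m) (Fin m) ℝ} (hW : NetworkAssumption G W)
    (hρ : rho W < 1) {b lam α β γ D : ℝ} (hb : BoundedHeterogeneity f g b) {s₀ : State m n r}
    (h0 : InitialBound f g s₀ D) (hlam : 1 ≤ lam) (hα : 0 < α) (hβ : 0 < β) (hγ : 0 < γ)
    (hsx : lam * α * (L / μ) * L ≤ (1 - rho W) / 200)
    (hsy : β * (lam - 1) * (L / μ) * L ≤ (1 - rho W) / 200)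
    (hsz : γ * (L / μ) * L ≤ (1 - rho W) / 200)
    (hdu : L / μ * α * L ≤ β * μ / 80) (hdv : L / μ * α * L * lam ≤ γ * μ / 32) (N : ℕ) :
    ∑ k ∈ Finset.range N, ‖gradient (Phi f g) (avg (ahead f g W lam α β γ s₀ k).x)‖ ^ 2
      ≤ 2 * D / α + 500 * (L ^ 2 * ((L / μ) ^ 2 * lam ^ 2 * D / (1 - rho W)
        + (lam - 1) * D / (β * μ) + lam ^ 2 * D / (γ * μ)
        + (L / μ * lam * α / (1 - rho W)) ^ 2 * (N * b ^ 2)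
        + (L / μ * (lam - 1) * (β * (lam - 1)) / (1 - rho W)) ^ 2 * (N * b ^ 2)
        + (L / μ * lam * γ / (1 - rho W)) ^ 2 * (N * b ^ 2))) := by
  have hL := h.L_pos
  have hμ := h.μ_pos
  have hδ : 0 < 1 - rho W := by linarith
  have hδ1 : 1 - rho W ≤ 1 := by linarith [rho_nonneg W]
  have hs : 0 ≤ lam - 1 := by linarith
  have hk : 1 ≤ L / μ := (one_le_div hμ).2 (h.mu_le_L hr)
  have hkμ : L / μ * μ = L := div_mul_cancel₀ _ hμ.ne'
  -- The smallness needed for consensus already implies both step conditions of the inner recursion,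
  -- because 1-ρ ≤ 1 and μ ≤ L.
  have hstep : ∀ t : ℝ, t * (L / μ) * L ≤ (1 - rho W) / 200 →
      t * L ^ 2 ≤ μ / 2 := fun t h1 => by
    have e : t * L ^ 2 = t * (L / μ) * L * μ := by field_simp
    rw [e]
    calc _ ≤ 1 / 2 * μ := by gcongr; linarith
      _ = _ := by ring
  have hstep' : ∀ t : ℝ, 0 ≤ t → t * (L / μ) * L ≤ (1 - rho W) / 200 → t * μ ≤ 1 := by
    intro t ht h1
    have h2 : t * μ ≤ t * (L / μ) * L := by
      calc t * μ ≤ t * L := mul_le_mul_of_nonneg_left (h.mu_le_L hr) ht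
        _ ≤ t * (L / μ) * L := by
          refine mul_le_mul_of_nonneg_right ?_ hL.le
          exact le_mul_of_one_le_right ht hk
    linarith
  set S : ℕ → State m n r := ahead f g W lam α β γ s₀ with hS
  have hS0 : S 0 = s₀ := rfl
  have hx : ∀ k, (S (k + 1)).x = fun i => mix W (S k).x i - α • outerDir f g lam (S k) i :=
    fun k => by rw [hS, ahead_succ]; rfl
  have hy : ∀ k, (S (k + 1)).y
      = fun i => mix W (S k).y i - (β * (lam - 1)) • gradY (g i) ((S k).x i) ((S k).y i) :=
    fun k => by rw [hS, ahead_succ, h.aheadStep_y]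
  have hz : ∀ k, (S (k + 1)).z
      = fun i => mix W (S k).z i - γ • gradY (g i) ((S k).x i) ((S k).z i) :=
    fun k => by rw [hS, ahead_succ]; rfl
  have hxa : ∀ k, avg (S (k + 1)).x = avg (S k).x - α • avg (outerDir f g lam (S k)) := fun k => by
    rw [hx, avg_sub, avg_smul, hW.avg_mix]
  have hya : ∀ k, avg (S (k + 1)).y
      = avg (S k).y - (β * (lam - 1)) • avg (fun i => gradY (g i) ((S k).x i) ((S k).y i)) :=
    fun k => by rw [hy, avg_sub, avg_smul, hW.avg_mix]
  have hza : ∀ k, avg (S (k + 1)).z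
      = avg (S k).z - γ • avg (fun i => gradY (g i) ((S k).x i) ((S k).z i)) :=
    fun k => by rw [hz, avg_sub, avg_smul, hW.avg_mix]
  have hD : 0 ≤ D := (consensusError_nonneg _).trans h0.cons_x
  have hsumX := hW.sum_consensusError_le hρ (v := fun k => (S k).x) hx
    (fun k => h.consensusError_outerDir_le hlam hb (S k)) h0.cons_x N
  have hsumY := hW.sum_consensusError_le hρ (v := fun k => (S k).y) hy
    (fun k => h.consensusError_gradY_le hb (S k).x (S k).y) h0.cons_y N
  have hsumZ := hW.sum_consensusError_le hρ (v := fun k => (S k).z) hz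
    (fun k => h.consensusError_gradY_le hb (S k).x (S k).z) h0.cons_z N
  have hsumU := h.sum_innerError_le (mul_nonneg hβ.le hs) (hstep _ hsy)
    (hstep' _ (mul_nonneg hβ.le hs) hsy) (x := fun k => (S k).x) (v := fun k => (S k).y)
    hxa hya h0.inner_y N
  have hsumV := h.sum_innerError_le hγ.le (hstep _ hsz) (hstep' _ hγ.le hsz)
    (x := fun k => (S k).x) (v := fun k => (S k).z) hxa hza h0.inner_z N
  have hαΦ : α * (L + L * (L / μ)) ≤ 1 / 4 := by
    have h1 : α * L * 1 ≤ α * L * (L / μ) := by gcongr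
    have h2 : 1 * (α * L * (L / μ)) ≤ lam * (α * L * (L / μ)) := by gcongr
    linarith
  have hsumA : α / 2 * ∑ k ∈ Finset.range N, ‖gradient (Phi f g) (avg (S k).x)‖ ^ 2
      + α / 4 * ∑ k ∈ Finset.range N, ‖avg (outerDir f g lam (S k))‖ ^ 2
      ≤ D + α / 2 * ∑ k ∈ Finset.range N, outerErrorBound g L lam (S k) := by
    have hsum := sum_add_le_of_step (V := fun k => Phi f g (avg (S k).x))
      (c := fun k => α / 2 * ‖gradient (Phi f g) (avg (S k).x)‖ ^ 2
        + α / 4 * ‖avg (outerDir f g lam (S k))‖ ^ 2)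
      (b := fun k => α / 2 * outerErrorBound g L lam (S k)) (fun k => by
        rw [hxa]
        refine (h.Phi_step hα.le hαΦ _ _).trans (add_le_add_right ?_ _)
        exact mul_le_mul_of_nonneg_left (h.norm_avg_outerDir_sub_sq_le hlam (S k))
          (by positivity)) N
    simp only [← Finset.mul_sum, Finset.sum_add_distrib] at hsum
    have := h0.gap (avg (S N).x)
    rw [← hS0] at this
    linarith
  simp only [← Finset.mul_sum, Finset.sum_add_distrib] at hsumX hsumY hsumZ
  refine sum_gradient_sq_le_of_recursions hL hk hμ hs hlam (by linarith) hδ hα hβ hγ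
    (Finset.sum_nonneg fun k _ => consensusError_nonneg (S k).x)
    (Finset.sum_nonneg fun k _ => consensusError_nonneg (S k).y)
    (Finset.sum_nonneg fun k _ => consensusError_nonneg (S k).z)
    (Finset.sum_nonneg fun k _ => innerError_nonneg g (S k).x (S k).y)
    (Finset.sum_nonneg fun k _ => innerError_nonneg g (S k).x (S k).z)
    (Finset.sum_nonneg fun k _ => by positivity) hD (by positivity)
    ?_ hsumX hsumY hsumZ hsumU hsumV hsumA hkμ hsx hsy hsz hdu hdv
  simp only [outerErrorBound, ← Finset.mul_sum, Finset.sum_add_distrib]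

end StronglyConcaveFamily

/-! ### Consequences of the step-size conditions -/

theorem le_sqrt_mul_sq {a c L κ : ℝ} (h : (c * κ) ^ 2 ≤ a) : c * κ * L ≤ √(a * L ^ 2) := by
  refine Real.le_sqrt_of_sq_le ?_
  rw [mul_pow]
  gcongr

theorem one_div_uBeta_sq {L μ : ℝ} : 1 / uBeta L μ ^ 2 = 16 * (L / μ) ^ 2 := by
  unfold uBeta
  rw [div_pow, one_div_div, mul_pow, div_pow]
  ring

theorem wGamma_le {L μ : ℝ} (hL : 0 < L) (hμ : 0 < μ) : wGamma L μ ≤ μ / 2 := by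
  unfold wGamma
  have : μ * L / (μ + L) ≤ μ := by
    rw [div_le_iff₀ (by positivity)]
    nlinarith
  linarith

/-- The constants 40, 20, 25 for p₁, p₂, p₃ match the factors 5, 10, 8 in the step-size bounds: each
product is 200, the denominator used in the summed recursions. -/
theorem le_sqrt_p₁ {L μ : ℝ} (hL : 0 < L) (hμ : 0 < μ) : 40 * (L / μ) * L ≤ √(p₁ L μ) := by
  refine le_sqrt_mul_sq ?_
  have h1 : 96 / uBeta L μ ^ 2 = 96 * (16 * (L / μ) ^ 2) := by rw [← one_div_uBeta_sq]; ring
  have hw : 0 < wGamma L μ := by unfold wGamma; positivity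
  have h2 : 4 * (L / μ) ^ 2 ≤ L ^ 2 / wGamma L μ ^ 2 := by
    rw [← div_pow, show 4 * (L / μ) ^ 2 = (L / (μ / 2)) ^ 2 by field_simp; norm_num]
    gcongr
    exact wGamma_le hL hμ
  rw [h1, mul_div_assoc]
  nlinarith

theorem le_sqrt_p₂ (L μ : ℝ) : 20 * (L / μ) * L ≤ √(p₂ L μ) := by
  refine le_sqrt_mul_sq ?_
  have h1 : 96 / uBeta L μ ^ 2 = 96 * (16 * (L / μ) ^ 2) := by rw [← one_div_uBeta_sq]; ring
  rw [h1]
  nlinarith [sq_nonneg (L / μ)]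

theorem le_sqrt_p₃ (L μ : ℝ) : 25 * (L / μ) * L ≤ √(p₃ L μ) := by
  refine le_sqrt_mul_sq ?_
  have h1 : 48 / uBeta L μ ^ 2 = 48 * (16 * (L / μ) ^ 2) := by rw [← one_div_uBeta_sq]; ring
  rw [h1]
  nlinarith [sq_nonneg (L / μ)]

namespace StepCondition

variable {LΦ Lf L μ ρ lam α β γ : ℝ}

/-- The spectral gap is read off a positive step size lying below a multiple of 1-ρ. -/
theorem rho_lt_one (h : StepCondition LΦ Lf L μ ρ lam α β γ) (hL : 0 < L) (hγ : 0 < γ) : ρ < 1 := by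
  have h1 := hγ.trans h.γ_lt₅
  have := (div_pos_iff_of_pos_right (by positivity : (0 : ℝ) < 16 * L)).1 h1
  linarith

theorem alpha_le (h : StepCondition LΦ Lf L μ ρ lam α β γ) (hL : 0 < L) (hμ : 0 < μ)
    (hlam : 0 < lam) (hα : 0 < α) : lam * α * (L / μ) * L ≤ (1 - ρ) / 200 := by
  have hp := le_sqrt_p₁ hL hμ
  have h0 : 0 < √(p₁ L μ) := lt_of_lt_of_le (by positivity) hp
  have h1 := (lt_div_iff₀ (by positivity)).1 h.α_lt₅
  have h2 := mul_le_mul_of_nonneg_left hp (by positivity : 0 ≤ α * lam)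
  linarith

theorem beta_le (h : StepCondition LΦ Lf L μ ρ lam α β γ) (hL : 0 < L) (hμ : 0 < μ)
    (hlam : 0 < lam) (hβ : 0 < β) : β * (lam - 1) * (L / μ) * L ≤ (1 - ρ) / 200 := by
  have hp := le_sqrt_p₂ L μ
  have h0 : 0 < √(p₂ L μ) := lt_of_lt_of_le (by positivity) hp
  have h1 := (lt_div_iff₀ (by positivity)).1 h.β_lt₃
  have h2 := mul_le_mul_of_nonneg_left hp (by positivity : 0 ≤ β * lam)
  have h3 : 0 ≤ β * (L / μ) * L := by positivity
  linarith

theorem gamma_le (h : StepCondition LΦ Lf L μ ρ lam α β γ) (hL : 0 < L) (hμ : 0 < μ)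
    (hγ : 0 < γ) : γ * (L / μ) * L ≤ (1 - ρ) / 200 := by
  have hp := le_sqrt_p₃ L μ
  have h0 : 0 < √(p₃ L μ) := lt_of_lt_of_le (by positivity) hp
  have h1 := (lt_div_iff₀ (by positivity)).1 h.γ_lt₃
  have h2 := mul_le_mul_of_nonneg_left hp hγ.le
  linarith

theorem alpha_le_beta (h : StepCondition LΦ Lf L μ ρ lam α β γ) (hL : 0 < L) (hμ : 0 < μ) :
    L / μ * α * L ≤ β * μ / 80 := by
  have h1 := h.α_lt₄.le
  calc L / μ * α * L ≤ L / μ * (μ ^ 2 / (80 * L ^ 2) * β) * L := by gcongr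
    _ = _ := by field_simp

theorem alpha_le_gamma (h : StepCondition LΦ Lf L μ ρ lam α β γ) (hL : 0 < L) (hμ : 0 < μ)
    (hlam : 0 < lam) (hγ : 0 < γ) : L / μ * α * L * lam ≤ γ * μ / 32 := by
  have h1 := (lt_div_iff₀ (by positivity)).1 h.α_lt₃
  have h2 := mul_le_mul_of_nonneg_right (wGamma_le hL hμ) hγ.le
  linarith

end StepCondition

/-- Conversion of the summed bound into a rate, with `q` in the role of `K^{1/3}`. -/
theorem rate_of_sum_le {A α β γ L μ lam Λ c C D b δ κ q N : ℝ} (hL : 0 < L) (hμ : 0 < μ)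
    (hκ : 1 ≤ κ) (hkκ : L / μ ≤ κ) (hlam : 1 ≤ lam) (hΛ : lam ≤ Λ) (hc : 0 < c)
    (hD : 0 ≤ D) (hδ : 0 < δ) (hq : 1 ≤ q) (hN : q ^ 3 ≤ N)
    (hα : 0 < α) (hβ : 0 < β) (hγ : 0 < γ)
    (hα1 : α⁻¹ ≤ κ ^ 2 * q / c) (hβ1 : β⁻¹ ≤ q / c) (hγ1 : γ⁻¹ ≤ q / c)
    (hα2 : α ≤ C / q) (hβ2 : β ≤ C / q) (hγ2 : γ ≤ C / q) (hδγ : γ ≤ δ / (16 * L))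
    (hA : A ≤ 2 * D / α + 500 * (L ^ 2 * ((L / μ) ^ 2 * lam ^ 2 * D / δ
        + (lam - 1) * D / (β * μ) + lam ^ 2 * D / (γ * μ)
        + (L / μ * lam * α / δ) ^ 2 * (N * b ^ 2)
        + (L / μ * (lam - 1) * (β * (lam - 1)) / δ) ^ 2 * (N * b ^ 2)
        + (L / μ * lam * γ / δ) ^ 2 * (N * b ^ 2)))) :
    1 / N * A ≤ (2 * D / c + 500 * (3 * (L * Λ ^ 2 * D / c) + 3 * (L ^ 2 * Λ ^ 4 * C ^ 2)))
      * (κ ^ 2 / q ^ 2 + κ ^ 2 * b ^ 2 / (δ ^ 2 * q ^ 2)) := by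
  have hq0 : 0 < q := by linarith
  have hN0 : 0 < N := lt_of_lt_of_le (by positivity) hN
  have hΛ1 : 1 ≤ Λ := hlam.trans hΛ
  have hs : 0 ≤ lam - 1 := by linarith
  have hk0 : 0 < L / μ := by positivity
  have hκ0 : 0 < κ := by linarith
  set n := N / q ^ 2 with hn
  have hqn : q ≤ n := by
    rw [hn, le_div_iff₀ (by positivity)]
    linarith [pow_succ q 2, mul_comm q (q ^ 2)]
  have hn0 : 0 < n := by linarith
  have hkk : (L / μ) ^ 2 ≤ κ ^ 2 := pow_le_pow_left₀ hk0.le hkκ 2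
  have hk1 : L / μ ≤ κ ^ 2 := hkκ.trans (le_self_pow₀ hκ two_ne_zero)
  have hl2 : lam ^ 2 ≤ Λ ^ 2 := pow_le_pow_left₀ (by linarith) hΛ 2
  have hlΛ : lam ≤ Λ ^ 2 := hΛ.trans (le_self_pow₀ hΛ1 two_ne_zero)
  have hs2 : lam - 1 ≤ Λ ^ 2 := by linarith
  have hqc : q / c ≤ n / c := by gcongr
  have t1 : 2 * D / α ≤ 2 * D / c * (κ ^ 2 * n) := by
    calc 2 * D / α = 2 * D * α⁻¹ := by rw [div_eq_mul_inv]
      _ ≤ 2 * D * (κ ^ 2 * n / c) := by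
        refine mul_le_mul_of_nonneg_left (hα1.trans ?_) (by positivity)
        gcongr
      _ = _ := by ring
  -- The start-up term D/(1-ρ) must not survive in the rate: γ ≤ (1-ρ)/(16L) and γ ≥ c/q bound
  -- L/(1-ρ) by q/c.
  have hLδ : L / δ ≤ n / c := by
    have h1 : γ * (16 * L) ≤ δ := (le_div_iff₀ (by positivity)).1 hδγ
    have h2 : L / δ ≤ γ⁻¹ := by
      rw [div_le_iff₀ hδ, inv_mul_eq_div, le_div_iff₀ hγ]
      have : 0 ≤ γ * L := by positivity
      linarith
    exact h2.trans (hγ1.trans hqc)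
  have t2 : L ^ 2 * ((L / μ) ^ 2 * lam ^ 2 * D / δ) ≤ L * Λ ^ 2 * D / c * (κ ^ 2 * n) := by
    calc L ^ 2 * ((L / μ) ^ 2 * lam ^ 2 * D / δ)
        = L * ((L / μ) ^ 2 * lam ^ 2 * D) * (L / δ) := by ring
      _ ≤ L * (κ ^ 2 * Λ ^ 2 * D) * (n / c) := by gcongr
      _ = _ := by ring
  have t3 : L ^ 2 * ((lam - 1) * D / (β * μ)) ≤ L * Λ ^ 2 * D / c * (κ ^ 2 * n) := by
    calc L ^ 2 * ((lam - 1) * D / (β * μ)) = L * (L / μ * (lam - 1) * D) * β⁻¹ := by field_simp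
      _ ≤ L * (κ ^ 2 * Λ ^ 2 * D) * (n / c) := by
        have := hβ1.trans hqc
        gcongr
      _ = _ := by ring
  have t4 : L ^ 2 * (lam ^ 2 * D / (γ * μ)) ≤ L * Λ ^ 2 * D / c * (κ ^ 2 * n) := by
    calc L ^ 2 * (lam ^ 2 * D / (γ * μ)) = L * (L / μ * lam ^ 2 * D) * γ⁻¹ := by field_simp
      _ ≤ L * (κ ^ 2 * Λ ^ 2 * D) * (n / c) := by
        have := hγ1.trans hqc
        gcongr
      _ = _ := by ring
  have net : ∀ {σ t : ℝ}, 0 ≤ σ → σ ≤ Λ ^ 2 → 0 ≤ t → t ≤ C / q →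
      L ^ 2 * ((L / μ * σ * t / δ) ^ 2 * (N * b ^ 2))
        ≤ L ^ 2 * Λ ^ 4 * C ^ 2 * (κ ^ 2 * b ^ 2 / δ ^ 2 * n) := by
    intro σ t hσ hσ' ht ht'
    calc _ ≤ L ^ 2 * ((κ * Λ ^ 2 * (C / q) / δ) ^ 2 * (N * b ^ 2)) := by gcongr
      _ = _ := by rw [hn]; field_simp
  have t5 := net (by linarith) hlΛ hα.le hα2
  have t7 := net (by linarith) hlΛ hγ.le hγ2
  have t6 : L ^ 2 * ((L / μ * (lam - 1) * (β * (lam - 1)) / δ) ^ 2 * (N * b ^ 2))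
      ≤ L ^ 2 * Λ ^ 4 * C ^ 2 * (κ ^ 2 * b ^ 2 / δ ^ 2 * n) := by
    have hss : (lam - 1) * (lam - 1) ≤ Λ ^ 2 := by
      rw [← pow_two]
      exact pow_le_pow_left₀ hs (by linarith) 2
    have := net (mul_nonneg hs hs) hss hβ.le hβ2
    convert this using 4
    ring
  set u := κ ^ 2 * n with hu
  set w := κ ^ 2 * b ^ 2 / δ ^ 2 * n with hw
  have hu0 : 0 ≤ u := by positivity
  have hw0 : 0 ≤ w := by positivity
  have hfin : A ≤ (2 * D / c + 500 * (3 * (L * Λ ^ 2 * D / c) + 3 * (L ^ 2 * Λ ^ 4 * C ^ 2)))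
      * (u + w) := by
    have h1 : 0 ≤ 2 * D / c * w := by positivity
    have h2 : 0 ≤ L * Λ ^ 2 * D / c * w := by positivity
    have h3 : 0 ≤ L ^ 2 * Λ ^ 4 * C ^ 2 * u := by positivity
    linarith
  have huw : κ ^ 2 / q ^ 2 + κ ^ 2 * b ^ 2 / (δ ^ 2 * q ^ 2) = (u + w) / N := by
    rw [hu, hw, hn]; field_simp
  rw [huw, ← mul_div_assoc, one_div, inv_mul_eq_div]
  exact div_le_div_of_nonneg_right hfin hN0.le

end DBO

/-! ### Assembly of both parts -/

theorem corollary2 :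
    -- (i) exactness of the penalty problem
    (∀ (m n r : ℕ) (f g : Fin m → Vec n → Vec r → ℝ) (L μ Cfy lam : ℝ),
      0 < m → 0 < L → 0 < μ → (∀ i x y, g i x y = -f i x y) →
      OuterAssumption f g L Cfy → InnerAssumption g μ L → 1 ≤ lam →
      -- pointwise claims: inner solutions, values and gradients
      (∀ x : Vec n,
        (∀ y, IsMinimizer (avgFun g x) y ↔ y = yStar g x) ∧
        IsGreatest (Set.range (avgFun f x)) (Phi f g x) ∧
        IsMinimizer (penalty f g lam x) (yStar g x) ∧
        IsMinimizer (penalty f g lam x) (yPen f g lam x) ∧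
        (1 < lam → (∀ y, IsMinimizer (penalty f g lam x) y ↔ y = yStar g x) ∧
          ‖yStar g x - yPen f g lam x‖ ^ 2 = 0) ∧
        pStar f g lam x = Phi f g x ∧
        HasGradientAt (Phi f g) (gradX (avgFun f) x (yStar g x)) x ∧
        DifferentiableAt ℝ (pStar f g lam) x ∧
        ‖gradient (Phi f g) x - gradient (pStar f g lam) x‖ ^ 2 = 0) ∧
      -- equivalence of the min-max problem and the penalty problem
      (∀ v : ℝ, IsGLB (Set.range (Phi f g)) v ↔
        IsGLB (Set.range fun q : Vec n × Vec r => penalty f g lam q.1 q.2) v) ∧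
      (∀ x y, IsMinMaxSol (avgFun f) x y →
        IsMinimizer (fun q : Vec n × Vec r => penalty f g lam q.1 q.2) (x, y)) ∧
      (∀ x y, IsMinimizer (fun q : Vec n × Vec r => penalty f g lam q.1 q.2) (x, y) →
        IsMinMaxSol (avgFun f) x (yStar g x) ∧ (1 < lam → IsMinMaxSol (avgFun f) x y))) ∧
    -- (ii) convergence rate
    (∀ L lamMax c C D : ℝ, 0 < L → 1 ≤ lamMax → 0 < c → c ≤ C →
      ∃ M : ℝ, 0 < M ∧
        ∀ (m n r : ℕ) (f g : Fin m → Vec n → Vec r → ℝ) (μ Cfy bf : ℝ)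
          (G : SimpleGraph (Fin m)) (W : Matrix (Fin m) (Fin m) ℝ)
          (lam α β γ : ℝ) (s₀ : State m n r) (K : ℕ),
          0 < r → 0 < μ → (∀ i x y, g i x y = -f i x y) →
          OuterAssumption f g L Cfy → InnerAssumption g μ L → NetworkAssumption G W →
          BoundedHeterogeneity f g bf →
          InitialBound f g s₀ D →
          1 ≤ lam → lam ≤ lamMax → 1 ≤ K →
          StepCondition (L + L * (L / μ)) L L μ (rho W) lam α β γ →
          OfOrder c C α ((kappa L L Cfy μ ^ 2)⁻¹ * (K : ℝ) ^ (-(1 / 3) : ℝ)) →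
          OfOrder c C β ((K : ℝ) ^ (-(1 / 3) : ℝ)) →
          OfOrder c C γ ((K : ℝ) ^ (-(1 / 3) : ℝ)) →
          (1 / ((K : ℝ) + 1)) * ∑ k ∈ Finset.range (K + 1),
              ‖gradient (Phi f g) (avg (ahead f g W lam α β γ s₀ k).x)‖ ^ 2
            ≤ M * (kappa L L Cfy μ ^ 2 / (K : ℝ) ^ (2 / 3 : ℝ)
              + kappa L L Cfy μ ^ 2 * bf ^ 2 / ((1 - rho W) ^ 2 * (K : ℝ) ^ (2 / 3 : ℝ)))) := by
  refine ⟨?_, ?_⟩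
  · intro m n r f g L μ Cfy lam hm hL hμ hg hf hg' hlam
    have h : StronglyConcaveFamily f g L μ :=
      ⟨hm, hL, hμ, hg, hf.smooth, hg'.smooth, hg'.strongConvex⟩
    refine ⟨fun x => ⟨h.isMinimizer_iff x, h.isGreatest_Phi x, h.isMinimizer_penalty_yStar hlam x,
      h.isMinimizer_penalty_yPen hlam x, fun hlam' => ⟨h.isMinimizer_penalty_iff hlam' x, ?_⟩,
      ?_, h.hasGradientAt_Phi x, ?_, ?_⟩, h.isGLB_iff hlam,
      fun x y => h.isMinimizer_penalty_of_isMinMaxSol hlam,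
      fun x y => h.isMinMaxSol_of_isMinimizer_penalty hlam⟩
    · rw [(h.isMinimizer_penalty_iff hlam' x _).1 (h.isMinimizer_penalty_yPen hlam x)]
      simp
    · rw [h.pStar_eq hlam]
    · rw [h.pStar_eq hlam]
      exact (h.hasGradientAt_Phi x).differentiableAt
    · rw [h.pStar_eq hlam]
      simp
  · intro L Λ c C D hL hΛ hc hcC
    -- M is chosen before any problem is given, so |D| secures its positivity; D ≥ 0 follows once an
    -- initialization satisfies the bounds.
    refine ⟨2 * |D| / c + 500 * (3 * (L * Λ ^ 2 * |D| / c) + 3 * (L ^ 2 * Λ ^ 4 * C ^ 2)), ?_, ?_⟩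
    · have hC : 0 < C := hc.trans_le hcC
      have hΛ0 : 0 < Λ := by linarith
      positivity
    intro m n r f g μ Cfy bf G W lam α β γ s₀ K hr hμ hg hf hg' hW hb h0 hlam hlamΛ hK hstep
      hα hβ hγ
    have h : StronglyConcaveFamily f g L μ :=
      ⟨hW.pos_card, hL, hμ, hg, hf.smooth, hg'.smooth, hg'.strongConvex⟩
    have hD : 0 ≤ D := (consensusError_nonneg _).trans h0.cons_x
    rw [abs_of_nonneg hD]
    set κ := kappa L L Cfy μ with hκdef
    have hkκ : L / μ ≤ κ := by
      rw [hκdef, kappa, max_self]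
      gcongr
      exact le_max_left _ _
    have hκ : 1 ≤ κ := ((one_le_div hμ).2 (h.mu_le_L hr)).trans hkκ
    have hK1 : (1 : ℝ) ≤ K := by exact_mod_cast hK
    have hK0 : (0 : ℝ) ≤ K := by linarith
    set q : ℝ := (K : ℝ) ^ (1 / 3 : ℝ) with hqdef
    have hq : 1 ≤ q := Real.one_le_rpow hK1 (by norm_num)
    have hq0 : 0 < q := by linarith
    have hq3 : q ^ 3 = K := by
      rw [hqdef, ← Real.rpow_natCast, ← Real.rpow_mul hK0]
      norm_num
    have hq2 : (K : ℝ) ^ (2 / 3 : ℝ) = q ^ 2 := by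
      rw [hqdef, ← Real.rpow_natCast, ← Real.rpow_mul hK0]
      norm_num
    have hqi : (K : ℝ) ^ (-(1 / 3) : ℝ) = q⁻¹ := Real.rpow_neg hK0 _
    rw [hqi] at hα hβ hγ
    rw [hq2]
    have hC : 0 < C := hc.trans_le hcC
    have hα0 : 0 < α := lt_of_lt_of_le (by positivity) hα.1
    have hβ0 : 0 < β := lt_of_lt_of_le (by positivity) hβ.1
    have hγ0 : 0 < γ := lt_of_lt_of_le (by positivity) hγ.1
    have hlam0 : 0 < lam := by linarith
    have hρ := hstep.rho_lt_one hL hγ0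
    have hsum := h.sum_gradient_sq_le hr hW hρ hb h0 hlam hα0 hβ0 hγ0
      (hstep.alpha_le hL hμ hlam0 hα0) (hstep.beta_le hL hμ hlam0 hβ0)
      (hstep.gamma_le hL hμ hγ0) (hstep.alpha_le_beta hL hμ)
      (hstep.alpha_le_gamma hL hμ hlam0 hγ0) (K + 1)
    have hinv : ∀ t : ℝ, 0 < t → c * q⁻¹ ≤ t → t⁻¹ ≤ q / c := fun t ht h1 => by
      have h2 := inv_anti₀ (by positivity) h1
      rwa [mul_inv, inv_inv, inv_mul_eq_div] at h2
    push_cast at hsum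
    -- Applied with N = K+1 summands and q = K^(1/3), so q³ = K ≤ N.
    refine rate_of_sum_le hL hμ hκ hkκ hlam hlamΛ hc hD (sub_pos.2 hρ) hq
      (hq3.le.trans (by linarith)) hα0 hβ0 hγ0 ?_ (hinv β hβ0 hβ.1) (hinv γ hγ0 hγ.1)
      ?_ hβ.2 hγ.2 hstep.γ_lt₅.le hsum
    · have h2 := inv_anti₀ (by positivity) hα.1
      rwa [mul_inv, mul_inv, inv_inv, inv_inv, inv_mul_eq_div] at h2
    -- As κ ≥ 1, the factor κ⁻² can be dropped in the upper bound for α; it matters only in the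
    -- lower bound, where D/α produces κ².
    · refine hα.2.trans ?_
      rw [div_eq_mul_inv]
      refine mul_le_mul_of_nonneg_left ?_ hC.le
      exact mul_le_of_le_one_left (by positivity) (inv_le_one_of_one_le₀ (one_le_pow₀ hκ))
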